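/- Let $\mathbb T=\mathbb R/\mathbb Z$ be the circle, identified with $[0,1]$ with endpoints glued, and let $C(\mathbb T)$ be the space of continuous real- or complex-valued functions on $\mathbb T$ with the supremum norm. **Random homeomorphism.** Let $X_{n,k}$ ($n\ge 1$, $0<k<2^n$ odd) be independent random variables, each uniformly distributed on $[0,1]$. Define $\varphi$ on the dyadic rationals of $[0,1]$ by $\varphi(0)=0$, $\varphi(1)=1$ and, for odd $0<k<2^n$, $$\varphi(k2^{-n})=\varphi((k-1)2^{-n})+X_{n,k}\bigl(\varphi((k+1)2^{-n})-\varphi((k-1)2^{-n})\bigr).$$ **Interval properties.** An interval property is a map $T$ assigning to each $f\in C(\mathbb T)$ and each interval $I=[x,y]\subseteq[0,1]$ (with $x\le y$) a value $T(f;I)\in\{0,1\}$, such that 1. $(f,x,y)\mapsto T(f;[x,y])$ is Borel measurable on $\{(f,x,y)\in C(\mathbb T)\times[0,1]^2: x\le y\}$; 2. if $f|_I=g|_I$ almost everywhere, then $T(f;I)=T(g;I)$; 3. $T(f;[x,y])=T(f;[x,t])\,T(f;[t,y])$ whenever $x\le t\le y$, and $T(f;[x,x])=1$; 4. $T(f\circ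 L;L^{-1}(I))=T(f;I)$ for every non-constant affine map $L:\mathbb R\to\mathbb R$ with $L^{-1}(I)\subseteq[0,1]$; that is, $T(g;L^{-1}(I))=T(f;I)$ for every $g\in C(\mathbb T)$ that coincides with $f\circ L$ on $L^{-1}(I)$. Write $T(f)=T(f;[0,1])$. **Theorem (0-1 law).** With probability $1$, $\varphi$ extends to an increasing homeomorphism of $[0,1]$, again denoted $\varphi$. For every interval property $T$ and every $f\in C(\mathbb T)$, the event $\{T(f\circ\varphi)=1\}$ is measurable (with respect to the completed probability measure) and $$\mathbb P\bigl(T(f\circ\varphi)=1\bigr)\in\{0,1\}.$$ Moreover, let $p$ be any Lebesgue measurable function on $\{0\le x\le y\le 1\}$ with $0\le p\le 1$ that satisfies $$p(x,y)=\frac1{y-x}\int_x^y p(x,t)\,p(t,y)\,dt\qquad\text{for all }0\le x<y\le 1 .$$ Then for almost every triple $0\le x<y<z\le 1$, $$p(x,z)\le p(x,y),\qquad p(x,z)\le p(y,z),\qquad p(x,z)=p(x,y)\,p(y,z).$$ -/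

import Mathlib

open MeasureTheory ProbabilityTheory Set
open scoped unitInterval

noncomputable section

namespace RandomHomeo

/-- The composition `f ∘ φ` of a continuous function `f` on the circle `ℝ / ℤ` (that is, `[0,1]` with
its endpoints identified) with an increasing homeomorphism `φ` of `[0,1]`, as a function on the
circle. Increasing homeomorphisms of `[0,1]` are exactly its order automorphisms. -/
def circleComp {𝕜 : Type*} [RCLike 𝕜] (f : C(UnitAddCircle, 𝕜)) (φ : I ≃o I) :
    C(UnitAddCircle, 𝕜) where
  toFun := AddCircle.liftIco 1 0
    (fun t : ℝ => f (((φ (projIcc 0 1 zero_le_one t) : I) : ℝ) : UnitAddCircle))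
  continuous_toFun := by
    apply AddCircle.liftIco_continuous
    · have h0 : projIcc (0 : ℝ) 1 zero_le_one 0 = ⊥ := projIcc_left _
      have h1 : projIcc (0 : ℝ) 1 zero_le_one (0 + 1) = ⊤ := by
        rw [zero_add]; exact projIcc_right _
      have e0 : (((⊥ : I) : ℝ)) = 0 := rfl
      have e1 : (((⊤ : I) : ℝ)) = 1 := rfl
      rw [h0, h1, map_bot, map_top, e0, e1]
      congr 1
      simpa using (AddCircle.coe_period (1 : ℝ)).symm
    · refine Continuous.continuousOn ?_
      exact f.continuous.comp ((AddCircle.continuous_mk' 1).comp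
        (continuous_subtype_val.comp (φ.continuous.comp continuous_projIcc)))

theorem circleComp_apply {𝕜 : Type*} [RCLike 𝕜] (f : C(UnitAddCircle, 𝕜)) (φ : I ≃o I) (x : I) :
    circleComp f φ ((x : ℝ) : UnitAddCircle) = f (((φ x : I) : ℝ) : UnitAddCircle) := by
  have key : ∀ y : I, (y : ℝ) < 1 →
      circleComp f φ ((y : ℝ) : UnitAddCircle) = f (((φ y : I) : ℝ) : UnitAddCircle) := by
    intro y hy
    have h := AddCircle.liftIco_coe_apply (p := (1 : ℝ)) (a := 0)
      (f := fun t : ℝ => f (((φ (projIcc 0 1 zero_le_one t) : I) : ℝ) : UnitAddCircle))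
      (x := (y : ℝ)) ⟨y.2.1, by simpa using hy⟩
    simpa [circleComp] using h
  rcases lt_or_eq_of_le x.2.2 with h | h
  · exact key x h
  · have hx : x = ⊤ := Subtype.ext h
    have e0 : (((⊥ : I) : ℝ)) = 0 := rfl
    have e1 : (((⊤ : I) : ℝ)) = 1 := rfl
    have c : ((1 : ℝ) : UnitAddCircle) = ((0 : ℝ) : UnitAddCircle) := by
      simp
    have k := key ⊥ (by rw [e0]; exact one_pos)
    rw [map_bot, e0] at k
    rw [hx, map_top, e1, c, k]

/-- Interval properties: maps `T(f; [x,y]) ∈ {0,1}` of a continuous function `f` on the circle and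
an interval `[x,y] ⊆ [0,1]`. Only the values `T f x y` with `x ≤ y` have a meaning. -/
structure IsIntervalProperty {𝕜 : Type*} [RCLike 𝕜]
    (T : C(UnitAddCircle, 𝕜) → I → I → Fin 2) : Prop where
  /-- `T` is Borel measurable on `{(f, x, y) | x ≤ y}`. -/
  borel_measurable :
    MeasurableSet[borel (C(UnitAddCircle, 𝕜) × I × I)]
      {q : C(UnitAddCircle, 𝕜) × I × I | q.2.1 ≤ q.2.2 ∧ T q.1 q.2.1 q.2.2 = 1}
  /-- `T(f; [x,y])` depends only on the values of `f` almost everywhere on `[x,y]`. -/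
  congr_ae : ∀ (f g : C(UnitAddCircle, 𝕜)) (x y : I), x ≤ y →
    (∀ᵐ t : ℝ ∂(volume.restrict (Icc (x : ℝ) (y : ℝ))),
      f (t : UnitAddCircle) = g (t : UnitAddCircle)) → T f x y = T g x y
  mul : ∀ (f : C(UnitAddCircle, 𝕜)) (x t y : I), x ≤ t → t ≤ y → T f x y = T f x t * T f t y
  refl : ∀ (f : C(UnitAddCircle, 𝕜)) (x : I), T f x x = 1
  /-- `T(f ∘ L; L⁻¹ [a,b]) = T(f; [a,b])` for every non-constant affine map `L t = r t + s` with
  `L⁻¹ [a,b] = [c,d] ⊆ [0,1]`. As `T(· ; [c,d])` depends only on the restriction to `[c,d]`,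
  `f ∘ L` is represented by any continuous `g` on the circle that coincides with it on `[c,d]`. -/
  affine : ∀ (f g : C(UnitAddCircle, 𝕜)) (r s : ℝ) (a b c d : I), r ≠ 0 → a ≤ b → c ≤ d →
    (fun t : ℝ => r * t + s) ⁻¹' Icc (a : ℝ) (b : ℝ) = Icc (c : ℝ) (d : ℝ) →
    (∀ t ∈ Icc (c : ℝ) (d : ℝ), g (t : UnitAddCircle) = f ((r * t + s : ℝ) : UnitAddCircle)) →
    T g c d = T f a b

/-- `X n k`, for `n : ℕ` and odd `0 < k < 2 ^ n`, are independent random variables, each uniformly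
distributed on `[0,1]`. The other `X n k` are not used. -/
structure IsUniformFamily {Ω : Type*} [MeasurableSpace Ω] (P : Measure Ω)
    (X : ℕ → ℕ → Ω → ℝ) : Prop where
  measurable : ∀ n k : ℕ, Odd k → k < 2 ^ n → Measurable (X n k)
  uniform : ∀ n k : ℕ, Odd k → k < 2 ^ n → pdf.IsUniform (X n k) (Icc (0 : ℝ) 1) P volume
  indep : iIndepFun (fun i : {q : ℕ × ℕ // Odd q.2 ∧ q.2 < 2 ^ q.1} => X i.1.1 i.1.2) P

/-- `dyadicValue ξ n k` is the value `φ(k 2⁻ⁿ)`, `0 ≤ k ≤ 2ⁿ`, obtained from the numbers `ξ`: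
`φ(0) = 0`, `φ(1) = 1` and, for odd `k`,
`φ(k 2⁻ⁿ) = φ((k-1) 2⁻ⁿ) + ξ n k * (φ((k+1) 2⁻ⁿ) - φ((k-1) 2⁻ⁿ))`. -/
def dyadicValue (ξ : ℕ → ℕ → ℝ) : ℕ → ℕ → ℝ
  | 0, k => k
  | n + 1, k =>
    if Even k then dyadicValue ξ n (k / 2)
    else dyadicValue ξ n (k / 2) +
      ξ (n + 1) k * (dyadicValue ξ n (k / 2 + 1) - dyadicValue ξ n (k / 2))

/-- The increasing homeomorphism `φ` of `[0,1]` extends the function defined on the dyadic rationals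
by `ξ`. There is at most one such `φ`. -/
def Extends (ξ : ℕ → ℕ → ℝ) (φ : I ≃o I) : Prop :=
  ∀ (x : I) (n k : ℕ), (x : ℝ) = (k : ℝ) / 2 ^ n → ((φ x : I) : ℝ) = dyadicValue ξ n k

/-- The set of `ω` for which the random homeomorphism `φ` exists and `T(f ∘ φ; [0,1]) = 1`. -/
def propertyEvent {𝕜 : Type*} [RCLike 𝕜] {Ω : Type*} (X : ℕ → ℕ → Ω → ℝ)
    (T : C(UnitAddCircle, 𝕜) → I → I → Fin 2) (f : C(UnitAddCircle, 𝕜)) : Set Ω :=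
  {ω | ∃ φ : I ≃o I, Extends (fun n k => X n k ω) φ ∧ T (circleComp f φ) 0 1 = 1}

/-- The triangle `{0 ≤ x ≤ y ≤ 1}`. -/
def triangle : Set (ℝ × ℝ) := {q | 0 ≤ q.1 ∧ q.1 ≤ q.2 ∧ q.2 ≤ 1}

end RandomHomeo

end

/-!
For a solution `p` of the integral equation and `D(x, z) = p(x, z) - p(x, y) p(y, z)`,
splitting the integral at `y` gives
`(z - x) D(x, z) = ∫ t in x..y, p(x, t) D(t, z) + ∫ t in y..z, D(x, t) p(t, z)`,
so `|D|` is subharmonic for the chain which replaces one of the two distances `y - x`, `z - y` by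
a uniform smaller one. It vanishes because its means over small rectangles at the corner tend
to `0`: at almost every diagonal point `p` has one-sided limits `0` or `1`.

The probability that `T` holds on `[x, y]` for the homeomorphism transplanted to `[x, y]` solves
this equation, by conditioning on the image of the midpoint. Its multiplicativity says that the
image of the midpoint does not influence the probability of the event; by induction, neither do
finitely many generations of ratios. The event is therefore independent of all the ratios, hence
of itself.
-/

namespace RandomHomeo

open Filter Topology

section BoundedMeasurable

/-- Bounded measurable real functions. All integrands of the averaging argument are of this kind,
so that their integrability over intervals is automatic. -/
structure IsBoundedMeasurable {α : Type*} [MeasurableSpace α] (F : α → ℝ) : Prop where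
  measurable : Measurable F
  exists_abs_le : ∃ M, ∀ a, |F a| ≤ M

namespace IsBoundedMeasurable

variable {α β : Type*} [MeasurableSpace α] [MeasurableSpace β] {F G : α → ℝ}

theorem const (c : ℝ) : IsBoundedMeasurable fun _ : α => c :=
  ⟨measurable_const, |c|, fun _ => le_rfl⟩

theorem of_mem_Icc {a b : ℝ} (hF : Measurable F) (hab : ∀ t, F t ∈ Icc a b) :
    IsBoundedMeasurable F :=
  ⟨hF, max |a| |b|, fun t => abs_le_max_abs_abs (hab t).1 (hab t).2⟩

theorem comp (hF : IsBoundedMeasurable F) {g : β → α} (hg : Measurable g) :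
    IsBoundedMeasurable fun t => F (g t) :=
  ⟨hF.measurable.comp hg, hF.exists_abs_le.imp fun _ hM t => hM (g t)⟩

theorem abs (hF : IsBoundedMeasurable F) : IsBoundedMeasurable fun t => |F t| :=
  ⟨continuous_abs.measurable.comp hF.measurable,
    hF.exists_abs_le.imp fun _ hM t => (abs_abs _).trans_le (hM t)⟩

theorem sub (hF : IsBoundedMeasurable F) (hG : IsBoundedMeasurable G) :
    IsBoundedMeasurable fun t => F t - G t := by
  obtain ⟨M, hM⟩ := hF.exists_abs_le
  obtain ⟨N, hN⟩ := hG.exists_abs_le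
  exact ⟨hF.measurable.sub hG.measurable, M + N,
    fun t => (abs_sub _ _).trans (add_le_add (hM t) (hN t))⟩

theorem mul (hF : IsBoundedMeasurable F) (hG : IsBoundedMeasurable G) :
    IsBoundedMeasurable fun t => F t * G t := by
  obtain ⟨M, hM⟩ := hF.exists_abs_le
  obtain ⟨N, hN⟩ := hG.exists_abs_le
  refine ⟨hF.measurable.mul hG.measurable, M * N, fun t => (abs_mul _ _).trans_le ?_⟩
  exact mul_le_mul (hM t) (hN t) (abs_nonneg _) ((abs_nonneg _).trans (hM t))

theorem bddAbove_image (hF : IsBoundedMeasurable F) (s : Set α) : BddAbove (F '' s) := by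
  obtain ⟨M, hM⟩ := hF.exists_abs_le
  exact ⟨M, forall_mem_image.2 fun t _ => (le_abs_self _).trans (hM t)⟩

theorem locallyIntegrable {F : ℝ → ℝ} (hF : IsBoundedMeasurable F) : LocallyIntegrable F := by
  obtain ⟨M, hM⟩ := hF.exists_abs_le
  exact (locallyIntegrable_const M).mono hF.measurable.aestronglyMeasurable
    (ae_of_all _ fun t => (hM t).trans (le_abs_self M))

theorem intervalIntegrable {F : ℝ → ℝ} (hF : IsBoundedMeasurable F) (a b : ℝ) :
    IntervalIntegrable F volume a b :=
  (hF.locallyIntegrable.integrableOn_isCompact isCompact_uIcc).intervalIntegrable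

theorem section_left {F : α → β → ℝ} (hF : IsBoundedMeasurable (Function.uncurry F)) (b : β) :
    IsBoundedMeasurable fun a => F a b :=
  hF.comp measurable_prodMk_right

theorem section_right {F : α → β → ℝ} (hF : IsBoundedMeasurable (Function.uncurry F)) (a : α) :
    IsBoundedMeasurable (F a) :=
  hF.comp measurable_prodMk_left

theorem intervalIntegral {F : α → ℝ → ℝ} (hF : IsBoundedMeasurable (Function.uncurry F))
    (a b : ℝ) : IsBoundedMeasurable fun s => ∫ r in a..b, F s r := by
  obtain ⟨M, hM⟩ := hF.exists_abs_le
  have measurable_integral (ν : Measure ℝ) [SFinite ν] : Measurable fun s => ∫ r, F s r ∂ν :=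
    hF.measurable.stronglyMeasurable.integral_prod_right.measurable
  exact ⟨(measurable_integral _).sub (measurable_integral _), M * |b - a|, fun s =>
    intervalIntegral.norm_integral_le_of_norm_le_const (f := F s) fun r _ => hM (s, r)⟩

theorem ae_integral_le_mul_add {g : ℝ → ℝ} (hg : IsBoundedMeasurable g) :
    ∀ᵐ x, ∀ ε > 0, ∃ δ > 0, ∀ h ∈ Ioo 0 δ,
      ∫ t in (x - h)..x, g t ≤ h * (g x + ε) ∧ ∫ t in x..(x + h), g t ≤ h * (g x + ε) := by
  filter_upwards [LocallyIntegrable.ae_hasDerivAt_integral hg.locallyIntegrable] with x hx ε hε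
  have isLittleO := hasDerivAt_iff_isLittleO_nhds_zero.1 (hx x)
  obtain ⟨δ, hδ, hbound⟩ := Metric.eventually_nhds_iff.1 (isLittleO.def hε)
  have abs_integral_sub_le {h : ℝ} (hh : |h| < δ) :
      |(∫ t in x..(x + h), g t) - h * g x| ≤ ε * |h| := by
    simpa using hbound (y := h) (by simpa using hh)
  refine ⟨δ, hδ, fun h ⟨h0, hh⟩ => ⟨?_, ?_⟩⟩
  · have deviation_le := abs_integral_sub_le (h := -h) (by rwa [abs_neg, abs_of_pos h0])
    rw [← sub_eq_add_neg, intervalIntegral.integral_symm, abs_neg, abs_of_pos h0] at deviation_le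
    linarith [(abs_le.1 deviation_le).1]
  · have deviation_le := abs_integral_sub_le (h := h) (by rwa [abs_of_pos h0])
    rw [abs_of_pos h0] at deviation_le
    linarith [(abs_le.1 deviation_le).2]

end IsBoundedMeasurable

theorem intervalIntegral_le_mul {F : ℝ → ℝ} {a b C : ℝ} (hab : a ≤ b)
    (hF : IntervalIntegrable F volume a b) (hC : ∀ t ∈ Ioo a b, F t ≤ C) :
    ∫ t in a..b, F t ≤ (b - a) * C := by
  simpa only [intervalIntegral.integral_const, smul_eq_mul] using
    intervalIntegral.integral_mono_on_of_le_Ioo hab hF (intervalIntegrable_const (c := C)) hC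

theorem abs_intervalIntegral_mul_le {F G : ℝ → ℝ} {a b : ℝ} (hab : a ≤ b)
    (hF : ∀ t, F t ∈ Icc 0 1) (hG : IntervalIntegrable G volume a b) :
    |∫ t in a..b, F t * G t| ≤ ∫ t in a..b, |G t| := by
  refine intervalIntegral.norm_integral_le_of_norm_le (f := fun t => F t * G t) hab
    (ae_of_all _ fun t _ => ?_) hG.norm
  rw [norm_mul, Real.norm_of_nonneg (hF t).1]
  exact mul_le_of_le_one_left (norm_nonneg _) (hF t).2

end BoundedMeasurable

section MaximumPrinciples

theorem forall_nonpos_of_contraction {α : Type*} {s : Set α} {F : α → ℝ} {q : ℝ} (hq0 : 0 ≤ q)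
    (hq1 : q < 1) (hF : BddAbove (F '' s))
    (h : ∀ C, 0 ≤ C → (∀ a ∈ s, F a ≤ C) → ∀ a ∈ s, F a ≤ C * q) : ∀ a ∈ s, F a ≤ 0 := by
  obtain ⟨M, hM⟩ := hF
  have geometric_bound (n : ℕ) : ∀ a ∈ s, F a ≤ max M 0 * q ^ n := by
    induction n with
    | zero => simpa using fun a ha => Or.inl (hM (mem_image_of_mem F ha))
    | succ n ih => simpa only [pow_succ, mul_assoc] using h _ (by positivity) ih
  have bound_tendsto : Tendsto (fun n : ℕ => max M 0 * q ^ n) atTop (𝓝 0) := by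
    simpa using (tendsto_pow_atTop_nhds_zero_of_lt_one hq0 hq1).const_mul (max M 0)
  exact fun a ha => ge_of_tendsto' bound_tendsto fun n => geometric_bound n a ha

/-- The right-hand side is a mean of `F` and of `0`, the latter with weight `(c - x) / (t - x)`. -/
theorem nonpos_of_mul_le_integral {F : ℝ → ℝ} {x c t : ℝ} (hx : x < c) (ht : c < t)
    (hF : IsBoundedMeasurable F) (h : ∀ w ∈ Ioc c t, (w - x) * F w ≤ ∫ s in c..w, F s) :
    F t ≤ 0 := by
  refine forall_nonpos_of_contraction (s := Ioc c t) (q := (t - c) / (t - x))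
    (div_nonneg (by linarith) (by linarith)) ((div_lt_one (by linarith)).2 (by linarith))
    (hF.bddAbove_image _) (fun C hC hFC w ⟨hcw, hwt⟩ => ?_) t ⟨ht, le_rfl⟩
  have mean_le : ∫ s in c..w, F s ≤ (w - c) * C :=
    intervalIntegral_le_mul hcw.le (hF.intervalIntegrable _ _)
      fun s hs => hFC s ⟨hs.1, hs.2.le.trans hwt⟩
  have hxw : 0 < w - x := by linarith
  calc F w ≤ C * ((w - c) / (w - x)) := by
        rw [← mul_div_assoc, le_div_iff₀ hxw]
        linarith [h w ⟨hcw, hwt⟩]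
    _ ≤ C * ((t - c) / (t - x)) := by
        gcongr ?_ * ?_
        rw [div_le_div_iff₀ hxw (by linarith)]
        nlinarith

/-- Bounded subharmonic functions on the open quadrant, for the Markov chain that moves from
`(u, v)` to a uniformly distributed point of the union of the segments from `(u, v)` to `(0, v)` and
to `(u, 0)`. -/
structure IsSubharmonic (F : ℝ → ℝ → ℝ) : Prop where
  isBoundedMeasurable : IsBoundedMeasurable (Function.uncurry F)
  mul_le_integral_add_integral : ∀ u v : ℝ, 0 < u → 0 < v →
    (u + v) * F u v ≤ (∫ s in 0..u, F s v) + ∫ r in 0..v, F u r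

/-- The means of `E` over the rectangles `[0,u] × [0,v]` with `u ≤ v` tend to zero at the
origin. -/
def HasVanishingMeans (E : ℝ → ℝ → ℝ) : Prop :=
  ∀ ε > 0, ∃ δ > 0, ∀ u v, 0 < u → u ≤ v → v < δ →
    ∫ s in 0..u, ∫ r in 0..v, E s r ≤ ε * (u * v)

namespace IsSubharmonic

variable {F : ℝ → ℝ → ℝ} (hF : IsSubharmonic F)

include hF

theorem swap : IsSubharmonic fun u v => F v u where
  isBoundedMeasurable := hF.isBoundedMeasurable.comp measurable_swap
  mul_le_integral_add_integral u v hu hv := by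
    linarith [hF.mul_le_integral_add_integral v u hv hu]

theorem intervalIntegrable_left (v a b : ℝ) : IntervalIntegrable (fun s => F s v) volume a b :=
  (hF.isBoundedMeasurable.section_left v).intervalIntegrable a b

theorem intervalIntegrable_right (u a b : ℝ) : IntervalIntegrable (F u) volume a b :=
  (hF.isBoundedMeasurable.section_right u).intervalIntegrable a b

theorem sub_const (c : ℝ) : IsSubharmonic fun u v => F u v - c where
  isBoundedMeasurable := hF.isBoundedMeasurable.sub (.const c)
  mul_le_integral_add_integral u v hu hv := by
    rw [intervalIntegral.integral_sub (hF.intervalIntegrable_left v 0 u) intervalIntegrable_const,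
      intervalIntegral.integral_sub (hF.intervalIntegrable_right u 0 v) intervalIntegrable_const]
    simp only [intervalIntegral.integral_const, smul_eq_mul]
    linarith [hF.mul_le_integral_add_integral u v hu hv]

theorem nonpos_of_nonpos_on_strip {U δ : ℝ} (hδ : 0 < δ)
    (h : ∀ u ∈ Ioo 0 U, ∀ r ∈ Ioo 0 δ, F u r ≤ 0) {u v : ℝ} (hu : u ∈ Ioo 0 U) (hv : 0 < v) :
    F u v ≤ 0 := by
  have hU : 0 < U := hu.1.trans hu.2
  have hL : 0 < U + (v + δ) := by linarith
  have hq : 0 ≤ 1 - δ / (U + (v + δ)) := sub_nonneg.2 ((div_le_one hL).2 (by linarith))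
  refine forall_nonpos_of_contraction (s := Ioo 0 U ×ˢ Ioo 0 (v + δ)) (F := Function.uncurry F)
    hq (by linarith [div_pos hδ hL]) (hF.isBoundedMeasurable.bddAbove_image _) ?_ (u, v)
    ⟨hu, hv, by linarith⟩
  rintro C hC hFC ⟨x, y⟩ ⟨hx, hy⟩
  simp only [mem_prod, and_imp, Prod.forall, Function.uncurry_apply_pair] at hFC ⊢
  rcases lt_or_ge y δ with hyδ | hδy
  · exact (h x hx y ⟨hy.1, hyδ⟩).trans (mul_nonneg hC hq)
  have left_le : ∫ s in 0..x, F s y ≤ (x - 0) * C :=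
    intervalIntegral_le_mul hx.1.le (hF.intervalIntegrable_left y 0 x)
      fun s hs => hFC s y ⟨hs.1, hs.2.trans hx.2⟩ hy
  have near_le : ∫ r in 0..δ, F x r ≤ (δ - 0) * 0 :=
    intervalIntegral_le_mul hδ.le (hF.intervalIntegrable_right x 0 δ) (h x hx)
  have far_le : ∫ r in δ..y, F x r ≤ (y - δ) * C :=
    intervalIntegral_le_mul hδy (hF.intervalIntegrable_right x δ y)
      fun r hr => hFC x r hx ⟨hδ.trans hr.1, hr.2.trans hy.2⟩
  have subharmonic := hF.mul_le_integral_add_integral x y hx.1 hy.1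
  rw [← intervalIntegral.integral_add_adjacent_intervals (hF.intervalIntegrable_right x 0 δ)
    (hF.intervalIntegrable_right x δ y)] at subharmonic
  have hxy : 0 < x + y := add_pos hx.1 hy.1
  calc F x y ≤ C * (1 - δ / (x + y)) := by
        rw [one_sub_div hxy.ne', ← mul_div_assoc, le_div_iff₀ hxy]
        linarith
    _ ≤ C * (1 - δ / (U + (v + δ))) := by
        gcongr
        · exact hx.2.le
        · exact hy.2.le

theorem nonpos_of_nonpos_on_square {δ : ℝ} (hδ : 0 < δ)
    (h : ∀ u ∈ Ioo 0 δ, ∀ v ∈ Ioo 0 δ, F u v ≤ 0) {u v : ℝ} (hu : 0 < u) (hv : 0 < v) :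
    F u v ≤ 0 :=
  hF.swap.nonpos_of_nonpos_on_strip (U := v + 1) hδ
    (fun _ hr _ hs => hF.nonpos_of_nonpos_on_strip hδ h hs hr.1) ⟨hv, lt_add_one v⟩ hu

/-- Substitute the bound `V` into the inequality at each `(s, v)` and average it over `s`: the
factor `1 / 2` is a bound for `s / (s + v)`. -/
theorem integral_le_of_mean_le (hF0 : ∀ u v, 0 ≤ F u v) {u v V ε : ℝ} (hu : 0 < u) (huv : u ≤ v)
    (hV : 0 ≤ V) (hFV : ∀ s ∈ Ioo 0 u, F s v ≤ V)
    (hmean : ∫ s in 0..u, ∫ r in 0..v, F s r ≤ ε * (u * v)) :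
    ∫ s in 0..u, F s v ≤ u * (V / 2 + ε) := by
  have hv : 0 < v := hu.trans_le huv
  have column_integrable := hF.isBoundedMeasurable.intervalIntegral 0 v |>.intervalIntegrable 0 u
  have pointwise : ∀ s ∈ Ioo 0 u, F s v ≤ V / 2 + (∫ r in 0..v, F s r) / v := by
    rintro s ⟨hs, hsu⟩
    have hsv : 0 < s + v := by linarith
    have row_le : ∫ w in 0..s, F w v ≤ (s - 0) * V :=
      intervalIntegral_le_mul hs.le (hF.intervalIntegrable_left v 0 s)
        fun w hw => hFV w ⟨hw.1, hw.2.trans hsu⟩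
    have column_nonneg : 0 ≤ ∫ r in 0..v, F s r :=
      intervalIntegral.integral_nonneg hv.le fun r _ => hF0 s r
    calc F s v ≤ s * V / (s + v) + (∫ r in 0..v, F s r) / (s + v) := by
          rw [← add_div, le_div_iff₀ hsv]
          linarith [hF.mul_le_integral_add_integral s v hs hv]
      _ ≤ V / 2 + (∫ r in 0..v, F s r) / v := by
          gcongr ?_ + (∫ r in 0..v, F s r) / ?_
          · rw [div_le_div_iff₀ hsv two_pos]
            nlinarith
          · exact le_add_of_nonneg_left hs.le
  calc ∫ s in 0..u, F s v
      ≤ ∫ s in 0..u, (V / 2 + (∫ r in 0..v, F s r) / v) :=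
        intervalIntegral.integral_mono_on_of_le_Ioo hu.le (hF.intervalIntegrable_left v 0 u)
          (intervalIntegrable_const.add (column_integrable.div_const v)) pointwise
    _ = u * (V / 2) + (∫ s in 0..u, ∫ r in 0..v, F s r) / v := by
        rw [intervalIntegral.integral_add intervalIntegrable_const
          (column_integrable.div_const v), intervalIntegral.integral_const,
          intervalIntegral.integral_div, smul_eq_mul, sub_zero]
    _ ≤ u * (V / 2) + ε * u := by
        gcongr
        rw [div_le_iff₀ hv]
        linarith
    _ = u * (V / 2 + ε) := by ring

/-- The previous bound controls the two segments starting at `(u, v)` up to the part of the vertical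
one above the diagonal, which the maximum principle removes. -/
theorem le_half_add_of_mean_le (hF0 : ∀ u v, 0 ≤ F u v) {V ε δ : ℝ} (hV : 0 ≤ V)
    (hFV : ∀ u ∈ Ioo 0 δ, ∀ v ∈ Ioo 0 δ, F u v ≤ V)
    (hmean : ∀ u v, 0 < u → u ≤ v → v < δ → ∫ s in 0..u, ∫ r in 0..v, F s r ≤ ε * (u * v))
    (hmean' : ∀ u v, 0 < u → u ≤ v → v < δ → ∫ s in 0..u, ∫ r in 0..v, F r s ≤ ε * (u * v))
    {u v : ℝ} (hu : 0 < u) (huv : u ≤ v) (hv : v < δ) : F u v ≤ V / 2 + ε := by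
  have horizontal_le {r : ℝ} (hur : u ≤ r) (hr : r < δ) :
      ∫ s in 0..u, F s r ≤ u * (V / 2 + ε) :=
    hF.integral_le_of_mean_le hF0 hu hur hV
      (fun s hs => hFV s ⟨hs.1, by linarith [hs.2]⟩ r ⟨by linarith, hr⟩) (hmean u r hu hur hr)
  have vertical_le : ∫ r in 0..u, F u r ≤ u * (V / 2 + ε) :=
    hF.swap.integral_le_of_mean_le (fun u v => hF0 v u) hu le_rfl hV
      (fun r hr => hFV u ⟨hu, by linarith⟩ r ⟨hr.1, by linarith [hr.2]⟩)
      (hmean' u u hu le_rfl (by linarith))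
  rcases huv.eq_or_lt with rfl | huv
  · have subharmonic := hF.mul_le_integral_add_integral u u hu hu
    refine le_of_mul_le_mul_left ?_ (add_pos hu hu)
    linarith [horizontal_le le_rfl hv]
  refine sub_nonpos.1 (nonpos_of_mul_le_integral (F := fun r => F u r - (V / 2 + ε))
    (neg_lt_self hu) huv ((hF.isBoundedMeasurable.section_right u).sub (.const _)) ?_)
  rintro w ⟨huw, hwv⟩
  have subharmonic := hF.mul_le_integral_add_integral u w hu (hu.trans huw)
  rw [← intervalIntegral.integral_add_adjacent_intervals (hF.intervalIntegrable_right u 0 u)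
    (hF.intervalIntegrable_right u u w)] at subharmonic
  rw [intervalIntegral.integral_sub (hF.intervalIntegrable_right u u w) intervalIntegrable_const,
    intervalIntegral.integral_const, smul_eq_mul]
  linarith [horizontal_le huw.le (hwv.trans_lt hv)]

theorem eq_zero (hF0 : ∀ u v, 0 ≤ F u v) (hmean : HasVanishingMeans F)
    (hmean' : HasVanishingMeans fun u v => F v u) {u v : ℝ} (hu : 0 < u) (hv : 0 < v) :
    F u v = 0 := by
  refine le_antisymm (le_of_forall_pos_le_add fun ε hε => ?_) (hF0 u v)
  obtain ⟨δ₁, hδ₁, mean_le⟩ := hmean (ε / 2) (half_pos hε)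
  obtain ⟨δ₂, hδ₂, mean_le'⟩ := hmean' (ε / 2) (half_pos hε)
  have hδ : 0 < min δ₁ δ₂ := lt_min hδ₁ hδ₂
  have le_on_square : ∀ a ∈ Ioo 0 (min δ₁ δ₂) ×ˢ Ioo 0 (min δ₁ δ₂),
      Function.uncurry F a - ε ≤ 0 := by
    refine forall_nonpos_of_contraction (q := 1 / 2) (by norm_num) (by norm_num)
      ((hF.isBoundedMeasurable.sub (.const ε)).bddAbove_image _) ?_
    rintro C hC hFC ⟨x, y⟩ ⟨hx, hy⟩
    have le_add : ∀ u ∈ Ioo 0 (min δ₁ δ₂), ∀ v ∈ Ioo 0 (min δ₁ δ₂), F u v ≤ C + ε :=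
      fun u hu v hv => sub_le_iff_le_add.1 (hFC (u, v) ⟨hu, hv⟩)
    have mean_le_min (u v : ℝ) (hu : 0 < u) (huv : u ≤ v) (hv : v < min δ₁ δ₂) :=
      mean_le u v hu huv (hv.trans_le (min_le_left _ _))
    have mean_le_min' (u v : ℝ) (hu : 0 < u) (huv : u ≤ v) (hv : v < min δ₁ δ₂) :=
      mean_le' u v hu huv (hv.trans_le (min_le_right _ _))
    have le_half_add : F x y ≤ (C + ε) / 2 + ε / 2 := by
      rcases le_total x y with hxy | hyx
      · exact hF.le_half_add_of_mean_le hF0 (by positivity) le_add mean_le_min mean_le_min'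
          hx.1 hxy hy.2
      · exact hF.swap.le_half_add_of_mean_le (fun u v => hF0 v u) (by positivity)
          (fun u hu v hv => le_add v hv u hu) mean_le_min' mean_le_min hy.1 hyx hx.2
    simp only [Function.uncurry_apply_pair]
    linarith
  have := (hF.sub_const ε).nonpos_of_nonpos_on_square hδ
    (fun u hu v hv => le_on_square (u, v) ⟨hu, hv⟩) hu hv
  linarith

end IsSubharmonic

end MaximumPrinciples

section SelfAveraging

/-- Measurable functions `p` of intervals with values in `[0,1]` such that `p x y` is the mean of
`p x t * p t y` over `t ∈ [x, y]`. -/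
structure IsSelfAveraging (p : ℝ → ℝ → ℝ) : Prop where
  measurable : Measurable (Function.uncurry p)
  nonneg : ∀ x y, 0 ≤ p x y
  le_one : ∀ x y, p x y ≤ 1
  eq_integral : ∀ x y, x < y → (y - x) * p x y = ∫ t in x..y, p x t * p t y

/-- The mean of `p x` over `[x, x + h]`. -/
noncomputable def rightMean (p : ℝ → ℝ → ℝ) (x h : ℝ) : ℝ := (∫ s in 0..h, p x (x + s)) / h

/-- The limit of the means of `p x` over `[x, x + h]` as `h` decreases to zero. As these means
increase, it is encoded as a supremum. -/
noncomputable def rightLimit (p : ℝ → ℝ → ℝ) (x : ℝ) : ℝ :=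
  ⨆ n : ℕ, rightMean p x (1 / ((n : ℝ) + 1))

/-- The reflection at the origin of a function of intervals, which exchanges the two endpoints. -/
def reflect (p : ℝ → ℝ → ℝ) : ℝ → ℝ → ℝ := fun x y => p (-y) (-x)

theorem integral_eq_mul_rightMean (p : ℝ → ℝ → ℝ) (x : ℝ) {h : ℝ} (h0 : 0 < h) :
    ∫ t in x..(x + h), p x t = h * rightMean p x h := by
  rw [rightMean, mul_div_cancel₀ _ h0.ne', intervalIntegral.integral_comp_add_left, add_zero]

namespace IsSelfAveraging

variable {p : ℝ → ℝ → ℝ} (hp : IsSelfAveraging p)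

include hp

theorem reflect : IsSelfAveraging (reflect p) where
  measurable := hp.measurable.comp
    ((measurable_neg.comp measurable_snd).prodMk (measurable_neg.comp measurable_fst))
  nonneg x y := hp.nonneg _ _
  le_one x y := hp.le_one _ _
  eq_integral x y hxy := by
    have eq_integral := hp.eq_integral (-y) (-x) (neg_lt_neg hxy)
    rw [← intervalIntegral.integral_comp_neg, neg_sub_neg] at eq_integral
    rw [RandomHomeo.reflect, eq_integral]
    exact intervalIntegral.integral_congr fun t _ => mul_comm _ _

theorem isBoundedMeasurable : IsBoundedMeasurable (Function.uncurry p) :=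
  .of_mem_Icc hp.measurable fun q => ⟨hp.nonneg q.1 q.2, hp.le_one q.1 q.2⟩

theorem isBoundedMeasurable_mul (x y : ℝ) : IsBoundedMeasurable fun t => p x t * p t y :=
  (hp.isBoundedMeasurable.section_right x).mul (hp.isBoundedMeasurable.section_left y)

theorem intervalIntegrable_right (x a b : ℝ) : IntervalIntegrable (p x) volume a b :=
  (hp.isBoundedMeasurable.section_right x).intervalIntegrable a b

theorem mul_le_integral {x y : ℝ} (hxy : x < y) : (y - x) * p x y ≤ ∫ t in x..y, p x t := by
  rw [hp.eq_integral x y hxy]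
  exact intervalIntegral.integral_mono_on hxy.le
    ((hp.isBoundedMeasurable_mul x y).intervalIntegrable _ _) (hp.intervalIntegrable_right _ _ _)
    fun t _ => mul_le_of_le_one_right (hp.nonneg _ _) (hp.le_one _ _)

theorem le_rightMean {x h y : ℝ} (h0 : 0 < h) (hy : x + h ≤ y) : p x y ≤ rightMean p x h := by
  have near_eq := integral_eq_mul_rightMean p x h0
  rcases hy.eq_or_lt with rfl | hy
  · refine le_of_mul_le_mul_left ?_ h0
    linarith [hp.mul_le_integral (lt_add_of_pos_right x h0)]
  refine sub_nonpos.1 (nonpos_of_mul_le_integral (F := fun t => p x t - rightMean p x h)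
    (lt_add_of_pos_right x h0) hy ((hp.isBoundedMeasurable.section_right x).sub (.const _)) ?_)
  rintro w ⟨hw, -⟩
  rw [intervalIntegral.integral_sub (hp.intervalIntegrable_right x _ _) intervalIntegrable_const,
    intervalIntegral.integral_const, smul_eq_mul]
  have mul_le := hp.mul_le_integral (x := x) (y := w) (by linarith)
  rw [← intervalIntegral.integral_add_adjacent_intervals (hp.intervalIntegrable_right x x (x + h))
    (hp.intervalIntegrable_right x (x + h) w)] at mul_le
  linarith

theorem rightMean_anti {x h h' : ℝ} (h0 : 0 < h) (hh : h ≤ h') :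
    rightMean p x h' ≤ rightMean p x h := by
  have h0' : 0 < h' := h0.trans_le hh
  have far_le : ∫ s in (x + h)..(x + h'), p x s ≤ ((x + h') - (x + h)) * rightMean p x h :=
    intervalIntegral_le_mul (by linarith) (hp.intervalIntegrable_right x _ _)
      fun s hs => hp.le_rightMean h0 hs.1.le
  refine le_of_mul_le_mul_left ?_ h0'
  rw [← integral_eq_mul_rightMean p x h0', ← intervalIntegral.integral_add_adjacent_intervals
    (hp.intervalIntegrable_right x x (x + h)) (hp.intervalIntegrable_right x (x + h) (x + h')),
    integral_eq_mul_rightMean p x h0]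
  linarith

theorem rightMean_nonneg {x h : ℝ} (h0 : 0 < h) : 0 ≤ rightMean p x h :=
  div_nonneg (intervalIntegral.integral_nonneg h0.le fun s _ => hp.nonneg x (x + s)) h0.le

theorem rightMean_le_one {x h : ℝ} (h0 : 0 < h) : rightMean p x h ≤ 1 := by
  refine le_of_mul_le_mul_left ?_ h0
  rw [← integral_eq_mul_rightMean p x h0]
  linarith [intervalIntegral_le_mul (le_add_of_nonneg_right h0.le)
    (hp.intervalIntegrable_right x x (x + h)) fun t _ => hp.le_one x t]

theorem rightMean_le_rightLimit {x h : ℝ} (h0 : 0 < h) : rightMean p x h ≤ rightLimit p x := by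
  obtain ⟨n, hn⟩ := exists_nat_one_div_lt h0
  have bddAbove : BddAbove (range fun n : ℕ => rightMean p x (1 / ((n : ℝ) + 1))) :=
    ⟨1, forall_mem_range.2 fun n => hp.rightMean_le_one (by positivity)⟩
  exact (hp.rightMean_anti (by positivity) hn.le).trans (le_ciSup bddAbove n)

theorem le_rightLimit {x y : ℝ} (hxy : x < y) : p x y ≤ rightLimit p x :=
  (hp.le_rightMean (sub_pos.2 hxy) (by linarith)).trans (hp.rightMean_le_rightLimit (sub_pos.2 hxy))

theorem le_rightLimit_reflect {x y : ℝ} (hxy : x < y) :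
    p x y ≤ rightLimit (RandomHomeo.reflect p) (-y) := by
  simpa only [RandomHomeo.reflect, neg_neg] using hp.reflect.le_rightLimit (neg_lt_neg hxy)

theorem rightLimit_le {x C δ : ℝ} (hδ : 0 < δ) (hC : ∀ h ∈ Ioo 0 δ, rightMean p x h ≤ C) :
    rightLimit p x ≤ C := by
  refine ciSup_le fun n => ?_
  have hn : (0 : ℝ) < 1 / ((n : ℝ) + 1) := by positivity
  have h0 : 0 < min (1 / ((n : ℝ) + 1)) (δ / 2) := lt_min hn (half_pos hδ)
  exact (hp.rightMean_anti h0 (min_le_left _ _)).trans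
    (hC _ ⟨h0, (min_le_right _ _).trans_lt (half_lt_self hδ)⟩)

theorem rightLimit_nonneg (x : ℝ) : 0 ≤ rightLimit p x :=
  (hp.rightMean_nonneg one_pos).trans (hp.rightMean_le_rightLimit one_pos)

theorem rightLimit_le_one (x : ℝ) : rightLimit p x ≤ 1 :=
  hp.rightLimit_le one_pos fun _ hh => hp.rightMean_le_one hh.1

theorem exists_forall_rightLimit_sub_lt (x : ℝ) {ε : ℝ} (hε : 0 < ε) :
    ∃ n : ℕ, ∀ h ∈ Ioc (0 : ℝ) (1 / ((n : ℝ) + 1)), rightLimit p x - ε < rightMean p x h := by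
  obtain ⟨n, hn⟩ := exists_lt_of_lt_ciSup (sub_lt_self (rightLimit p x) hε)
  exact ⟨n, fun h hh => hn.trans_le (hp.rightMean_anti hh.1 hh.2)⟩

theorem measurable_rightMean (h : ℝ) : Measurable fun x => rightMean p x h := by
  have isBoundedMeasurable : IsBoundedMeasurable (Function.uncurry fun x s => p x (x + s)) :=
    hp.isBoundedMeasurable.comp (measurable_fst.prodMk measurable_add)
  exact (isBoundedMeasurable.intervalIntegral 0 h).measurable.div_const h

theorem isBoundedMeasurable_rightMean {h : ℝ} (h0 : 0 < h) :
    IsBoundedMeasurable fun x => rightMean p x h :=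
  .of_mem_Icc (hp.measurable_rightMean h) fun _ => ⟨hp.rightMean_nonneg h0, hp.rightMean_le_one h0⟩

theorem isBoundedMeasurable_rightLimit : IsBoundedMeasurable (rightLimit p) :=
  .of_mem_Icc (Measurable.iSup fun _ => hp.measurable_rightMean _)
    fun x => ⟨hp.rightLimit_nonneg x, hp.rightLimit_le_one x⟩

/-- Both factors of `p x t * p t y` are bounded by right limits, and almost every point is a
Lebesgue point of the right limit. -/
theorem ae_rightLimit_le_sq : ∀ᵐ x, rightLimit p x ≤ rightLimit p x ^ 2 := by
  filter_upwards [hp.isBoundedMeasurable_rightLimit.ae_integral_le_mul_add] with x hx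
  refine le_of_forall_pos_le_add fun ε hε => ?_
  obtain ⟨δ, hδ, mean_le⟩ := hx ε hε
  have ℓ_nonneg := hp.rightLimit_nonneg x
  have ℓ_le_one := hp.rightLimit_le_one x
  have le_sq_add {y : ℝ} (hy : y ∈ Ioo x (x + δ)) : p x y ≤ rightLimit p x ^ 2 + ε := by
    refine le_of_mul_le_mul_left ?_ (sub_pos.2 hy.1)
    calc (y - x) * p x y = ∫ t in x..y, p x t * p t y := hp.eq_integral x y hy.1
      _ ≤ ∫ t in x..y, rightLimit p x * rightLimit p t :=
        intervalIntegral.integral_mono_on_of_le_Ioo hy.1.le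
          ((hp.isBoundedMeasurable_mul x y).intervalIntegrable _ _)
          ((hp.isBoundedMeasurable_rightLimit.intervalIntegrable _ _).const_mul _) fun t ht =>
          mul_le_mul (hp.le_rightLimit ht.1) (hp.le_rightLimit ht.2) (hp.nonneg _ _) ℓ_nonneg
      _ = rightLimit p x * ∫ t in x..(x + (y - x)), rightLimit p t := by
        rw [intervalIntegral.integral_const_mul, add_sub_cancel]
      _ ≤ rightLimit p x * ((y - x) * (rightLimit p x + ε)) := by
        gcongr
        exact (mean_le (y - x) ⟨sub_pos.2 hy.1, by linarith [hy.2]⟩).2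
      _ = (y - x) * (rightLimit p x ^ 2 + rightLimit p x * ε) := by ring
      _ ≤ (y - x) * (rightLimit p x ^ 2 + ε) := by
        gcongr
        · exact sub_nonneg.2 hy.1.le
        · exact mul_le_of_le_one_left hε.le ℓ_le_one
  refine hp.rightLimit_le hδ fun h hh => le_of_mul_le_mul_left ?_ hh.1
  rw [← integral_eq_mul_rightMean p x hh.1]
  simpa only [add_sub_cancel_left] using intervalIntegral_le_mul (by linarith [hh.1])
    (hp.intervalIntegrable_right x x (x + h)) fun t ht => le_sq_add ⟨ht.1, by linarith [ht.2, hh.2]⟩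

theorem ae_rightLimit_eq_zero_or_one : ∀ᵐ x, rightLimit p x = 0 ∨ rightLimit p x = 1 := by
  filter_upwards [hp.ae_rightLimit_le_sq] with x hx
  refine or_iff_not_imp_left.2 fun hx0 => le_antisymm (hp.rightLimit_le_one x) ?_
  have ℓ_pos : 0 < rightLimit p x := (hp.rightLimit_nonneg x).lt_of_ne' hx0
  exact le_of_mul_le_mul_left (by linarith) ℓ_pos

theorem ae_rightLimit_le_rightLimit_reflect :
    ∀ᵐ x, rightLimit p x ≤ rightLimit (RandomHomeo.reflect p) (-x) := by
  have isBoundedMeasurable : IsBoundedMeasurable fun x => rightLimit (RandomHomeo.reflect p) (-x) :=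
    hp.reflect.isBoundedMeasurable_rightLimit.comp measurable_neg
  filter_upwards [isBoundedMeasurable.ae_integral_le_mul_add] with x hx
  refine le_of_forall_pos_le_add fun ε hε => ?_
  obtain ⟨δ, hδ, mean_le⟩ := hx ε hε
  refine hp.rightLimit_le hδ fun h hh => le_of_mul_le_mul_left ?_ hh.1
  calc h * rightMean p x h = ∫ t in x..(x + h), p x t := (integral_eq_mul_rightMean p x hh.1).symm
    _ ≤ ∫ t in x..(x + h), rightLimit (RandomHomeo.reflect p) (-t) :=
      intervalIntegral.integral_mono_on_of_le_Ioo (by linarith [hh.1])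
        (hp.intervalIntegrable_right _ _ _) (isBoundedMeasurable.intervalIntegrable _ _)
        fun t ht => hp.le_rightLimit_reflect ht.1
    _ ≤ _ := (mean_le h hh).2

end IsSelfAveraging

end SelfAveraging

section Multiplicativity

/-- The defect of multiplicativity of a function `p` of intervals when `[y - u, y + v]` is cut
at `y`, as a function of `(u, v)`. -/
def mulDefect (p : ℝ → ℝ → ℝ) (y u v : ℝ) : ℝ := p (y - u) (y + v) - p (y - u) y * p y (y + v)

theorem mulDefect_reflect (p : ℝ → ℝ → ℝ) (y u v : ℝ) :
    mulDefect (reflect p) (-y) u v = mulDefect p y v u := by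
  simp only [mulDefect, reflect, neg_neg, neg_add_rev, neg_sub', sub_neg_eq_add]
  ring_nf

theorem abs_sub_mul_le {a b c : ℝ} (ha : a ≤ 1) (hb : b ∈ Icc 0 1) (hc : c ∈ Icc 0 1) :
    |a - b * c| ≤ (1 - a) + ((1 - b) + (1 - c)) := by
  refine abs_sub_le_iff.2 ⟨?_, ?_⟩
  · nlinarith [mul_nonneg (sub_nonneg.2 hb.2) (sub_nonneg.2 hc.2)]
  · linarith [mul_le_one₀ hb.2 hc.1 hc.2, hb.2, hc.2]

namespace IsSelfAveraging

variable {p : ℝ → ℝ → ℝ} (hp : IsSelfAveraging p)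

include hp

theorem isBoundedMeasurable_mulDefect (y : ℝ) :
    IsBoundedMeasurable (Function.uncurry (mulDefect p y)) := by
  have hu : Measurable fun q : ℝ × ℝ => y - q.1 := measurable_fst.const_sub y
  have hv : Measurable fun q : ℝ × ℝ => y + q.2 := measurable_snd.const_add y
  exact (hp.isBoundedMeasurable.comp (hu.prodMk hv)).sub
    ((hp.isBoundedMeasurable.comp (hu.prodMk measurable_const)).mul
      (hp.isBoundedMeasurable.comp (measurable_const.prodMk hv)))

theorem isBoundedMeasurable_abs_mulDefect (y : ℝ) :
    IsBoundedMeasurable (Function.uncurry fun u v => |mulDefect p y u v|) :=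
  (hp.isBoundedMeasurable_mulDefect y).abs

theorem isBoundedMeasurable_one_sub (y : ℝ) :
    IsBoundedMeasurable (Function.uncurry fun s r => 1 - p (y - s) (y + r)) :=
  (IsBoundedMeasurable.const 1).sub (hp.isBoundedMeasurable.comp
    ((measurable_fst.const_sub y).prodMk (measurable_snd.const_add y)))

theorem integral_mul_mulDefect (y v : ℝ) {u : ℝ} (hu : 0 < u) :
    ∫ s in 0..u, p (y - u) (y - s) * mulDefect p y s v =
      (∫ t in (y - u)..y, p (y - u) t * p t (y + v)) - u * (p (y - u) y * p y (y + v)) := by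
  have integrable (z a b : ℝ) := (hp.isBoundedMeasurable_mul (y - u) z).intervalIntegrable a b
  have integral_mul := hp.eq_integral (y - u) y (sub_lt_self y hu)
  rw [sub_sub_cancel] at integral_mul
  calc ∫ s in 0..u, p (y - u) (y - s) * mulDefect p y s v
      = ∫ s in 0..u, (fun t => p (y - u) t * p t (y + v) - p (y - u) t * p t y * p y (y + v))
          (y - s) :=
        intervalIntegral.integral_congr fun s _ => by
          simp only [mulDefect]
          ring
    _ = ∫ t in (y - u)..y, (p (y - u) t * p t (y + v) - p (y - u) t * p t y * p y (y + v)) := by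
        rw [intervalIntegral.integral_comp_sub_left (fun t => p (y - u) t * p t (y + v) -
          p (y - u) t * p t y * p y (y + v)), sub_zero]
    _ = _ := by
        rw [intervalIntegral.integral_sub (integrable _ _ _) ((integrable _ _ _).mul_const _),
          intervalIntegral.integral_mul_const, ← integral_mul, mul_assoc]

theorem integral_mulDefect_mul (y u : ℝ) {v : ℝ} (hv : 0 < v) :
    ∫ r in 0..v, mulDefect p y u r * p (y + r) (y + v) =
      (∫ t in y..(y + v), p (y - u) t * p t (y + v)) - v * (p (y - u) y * p y (y + v)) := by
  have integrable (x a b : ℝ) := (hp.isBoundedMeasurable_mul x (y + v)).intervalIntegrable a b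
  have integral_mul := hp.eq_integral y (y + v) (lt_add_of_pos_right y hv)
  rw [add_sub_cancel_left] at integral_mul
  calc ∫ r in 0..v, mulDefect p y u r * p (y + r) (y + v)
      = ∫ r in 0..v, (fun t => p (y - u) t * p t (y + v) - p (y - u) y * (p y t * p t (y + v)))
          (y + r) :=
        intervalIntegral.integral_congr fun r _ => by
          simp only [mulDefect]
          ring
    _ = ∫ t in y..(y + v), (p (y - u) t * p t (y + v) - p (y - u) y * (p y t * p t (y + v))) := by
        rw [intervalIntegral.integral_comp_add_left (fun t => p (y - u) t * p t (y + v) -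
          p (y - u) y * (p y t * p t (y + v))), add_zero]
    _ = _ := by
        rw [intervalIntegral.integral_sub (integrable _ _ _) ((integrable _ _ _).const_mul _),
          intervalIntegral.integral_const_mul, ← integral_mul, mul_left_comm]

theorem mul_mulDefect_eq_integral_add_integral (y : ℝ) {u v : ℝ} (hu : 0 < u) (hv : 0 < v) :
    (u + v) * mulDefect p y u v =
      (∫ s in 0..u, p (y - u) (y - s) * mulDefect p y s v) +
        ∫ r in 0..v, mulDefect p y u r * p (y + r) (y + v) := by
  have integrable (a b : ℝ) :=
    (hp.isBoundedMeasurable_mul (y - u) (y + v)).intervalIntegrable a b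
  have integral_mul := hp.eq_integral (y - u) (y + v) (by linarith)
  rw [← intervalIntegral.integral_add_adjacent_intervals (integrable _ y) (integrable y _)]
    at integral_mul
  rw [hp.integral_mul_mulDefect y v hu, hp.integral_mulDefect_mul y u hv, mulDefect]
  linarith

theorem isSubharmonic_abs_mulDefect (y : ℝ) : IsSubharmonic fun u v => |mulDefect p y u v| where
  isBoundedMeasurable := hp.isBoundedMeasurable_abs_mulDefect y
  mul_le_integral_add_integral u v hu hv := by
    have bounded := hp.isBoundedMeasurable_mulDefect y
    have left_le : |∫ s in 0..u, p (y - u) (y - s) * mulDefect p y s v| ≤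
        ∫ s in 0..u, |mulDefect p y s v| :=
      abs_intervalIntegral_mul_le hu.le (fun s => ⟨hp.nonneg _ _, hp.le_one _ _⟩)
        ((bounded.section_left v).intervalIntegrable 0 u)
    have right_le : |∫ r in 0..v, mulDefect p y u r * p (y + r) (y + v)| ≤
        ∫ r in 0..v, |mulDefect p y u r| := by
      simpa only [mul_comm] using
        abs_intervalIntegral_mul_le hv.le (F := fun r => p (y + r) (y + v))
          (fun r => ⟨hp.nonneg _ _, hp.le_one _ _⟩)
          ((bounded.section_right u).intervalIntegrable 0 v)
    calc (u + v) * |mulDefect p y u v| = |(u + v) * mulDefect p y u v| := by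
          rw [abs_mul, abs_of_pos (add_pos hu hv)]
      _ ≤ _ := by
          rw [hp.mul_mulDefect_eq_integral_add_integral y hu hv]
          exact (abs_add_le _ _).trans (add_le_add left_le right_le)

/-- The double mean of `p (y - s) (y + r)`, `s ≤ u` and `r ≤ v`, is bounded below by a mean of the
right means at the left endpoints `y - s` because `[y, y + v]` is at least half of
`[y - s, y - s + 2 * v]`. -/
theorem integral_one_sub_le {y u v η : ℝ} (hu : 0 < u) (huv : u ≤ v) (hη : 2 * v ≤ η) :
    ∫ s in 0..u, ∫ r in 0..v, (1 - p (y - s) (y + r)) ≤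
      2 * v * ∫ t in (y - u)..y, (1 - rightMean p t η) := by
  have hv : 0 < v := hu.trans_le huv
  have row_le {s : ℝ} (hs : s ∈ Ioo 0 u) :
      ∫ r in 0..v, (1 - p (y - s) (y + r)) ≤ 2 * v * (1 - rightMean p (y - s) η) := by
    have integrable (a b : ℝ) : IntervalIntegrable (fun t => 1 - p (y - s) t) volume a b :=
      intervalIntegrable_const.sub (hp.intervalIntegrable_right (y - s) a b)
    calc ∫ r in 0..v, (1 - p (y - s) (y + r))
        = ∫ t in y..(y + v), (1 - p (y - s) t) := by
          rw [intervalIntegral.integral_comp_add_left (fun t => 1 - p (y - s) t), add_zero]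
      _ ≤ ∫ t in (y - s)..(y - s + 2 * v), (1 - p (y - s) t) :=
          intervalIntegral.integral_mono_interval (by linarith [hs.1]) (by linarith)
            (by linarith [hs.2]) (ae_of_all _ fun t => sub_nonneg.2 (hp.le_one _ t))
            (integrable _ _)
      _ = 2 * v * (1 - rightMean p (y - s) (2 * v)) := by
          rw [intervalIntegral.integral_sub intervalIntegrable_const
            (hp.intervalIntegrable_right _ _ _), integral_eq_mul_rightMean p _ (by positivity),
            intervalIntegral.integral_const, smul_eq_mul]
          ring
      _ ≤ 2 * v * (1 - rightMean p (y - s) η) := by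
          gcongr
          exact hp.rightMean_anti (by positivity) hη
  have mean_bounded : IsBoundedMeasurable fun t => 1 - rightMean p t η :=
    (IsBoundedMeasurable.const 1).sub (hp.isBoundedMeasurable_rightMean (by linarith))
  calc ∫ s in 0..u, ∫ r in 0..v, (1 - p (y - s) (y + r))
      ≤ ∫ s in 0..u, 2 * v * (1 - rightMean p (y - s) η) :=
        intervalIntegral.integral_mono_on_of_le_Ioo hu.le
          (((hp.isBoundedMeasurable_one_sub y).intervalIntegral 0 v).intervalIntegrable 0 u)
          (((mean_bounded.comp (measurable_id.const_sub y)).intervalIntegrable 0 u).const_mul _)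
          fun s hs => row_le hs
    _ = 2 * v * ∫ t in (y - u)..y, (1 - rightMean p t η) := by
        rw [intervalIntegral.integral_const_mul,
          intervalIntegral.integral_comp_sub_left (fun t => 1 - rightMean p t η), sub_zero]

theorem integral_one_sub_eq (x : ℝ) {h : ℝ} (h0 : 0 < h) :
    ∫ s in 0..h, (1 - p x (x + s)) = h * (1 - rightMean p x h) := by
  have integrable : IntervalIntegrable (fun s => p x (x + s)) volume 0 h :=
    ((hp.isBoundedMeasurable.section_right x).comp (measurable_const_add x)).intervalIntegrable 0 h
  rw [intervalIntegral.integral_sub intervalIntegrable_const integrable,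
    intervalIntegral.integral_const, smul_eq_mul, rightMean]
  field_simp
  ring

theorem integral_abs_mulDefect_right_le (y s : ℝ) {v : ℝ} (hv : 0 < v) :
    ∫ r in 0..v, |mulDefect p y s r| ≤
      (∫ r in 0..v, (1 - p (y - s) (y + r))) +
        v * ((1 - p (y - s) y) + (1 - rightMean p y v)) := by
  have mem_Icc (a b : ℝ) : p a b ∈ Icc 0 1 := ⟨hp.nonneg a b, hp.le_one a b⟩
  have both_integrable : IntervalIntegrable (fun r => 1 - p (y - s) (y + r)) volume 0 v :=
    ((hp.isBoundedMeasurable_one_sub y).section_right s).intervalIntegrable 0 v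
  have right_integrable : IntervalIntegrable (fun r => 1 - p y (y + r)) volume 0 v := by
    simpa only [sub_zero] using
      ((hp.isBoundedMeasurable_one_sub y).section_right 0).intervalIntegrable 0 v
  have rest_integrable := (intervalIntegrable_const (c := 1 - p (y - s) y)).add right_integrable
  calc ∫ r in 0..v, |mulDefect p y s r|
      ≤ ∫ r in 0..v, ((1 - p (y - s) (y + r)) + ((1 - p (y - s) y) + (1 - p y (y + r)))) :=
        intervalIntegral.integral_mono_on hv.le
          (((hp.isBoundedMeasurable_mulDefect y).section_right s).intervalIntegrable 0 v).norm
          (both_integrable.add rest_integrable)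
          fun r _ => abs_sub_mul_le (hp.le_one _ _) (mem_Icc _ _) (mem_Icc _ _)
    _ = _ := by
        rw [intervalIntegral.integral_add both_integrable rest_integrable,
          intervalIntegral.integral_add intervalIntegrable_const right_integrable,
          hp.integral_one_sub_eq y hv, intervalIntegral.integral_const, smul_eq_mul, sub_zero,
          mul_add]

theorem integral_abs_mulDefect_le {y u v η : ℝ} (hu : 0 < u) (huv : u ≤ v) (hη : 2 * v ≤ η) :
    ∫ s in 0..u, ∫ r in 0..v, |mulDefect p y s r| ≤
      (2 * v * ∫ t in (y - u)..y, (1 - rightMean p t η)) +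
        u * v * ((1 - rightMean (RandomHomeo.reflect p) (-y) u) + (1 - rightMean p y v)) := by
  have hv : 0 < v := hu.trans_le huv
  have left_integrable : IntervalIntegrable (fun s => 1 - p (y - s) y) volume 0 u := by
    simpa only [add_zero] using
      ((hp.isBoundedMeasurable_one_sub y).section_left 0).intervalIntegrable 0 u
  have left_integral : ∫ s in 0..u, (1 - p (y - s) y) =
      u * (1 - rightMean (RandomHomeo.reflect p) (-y) u) := by
    rw [← hp.reflect.integral_one_sub_eq (-y) hu]
    simp only [RandomHomeo.reflect, neg_add', neg_neg]
  have both_integrable :=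
    ((hp.isBoundedMeasurable_one_sub y).intervalIntegral 0 v).intervalIntegrable 0 u
  have rest_integrable : IntervalIntegrable
      (fun s => v * ((1 - p (y - s) y) + (1 - rightMean p y v))) volume 0 u :=
    (left_integrable.add intervalIntegrable_const).const_mul v
  calc ∫ s in 0..u, ∫ r in 0..v, |mulDefect p y s r|
      ≤ ∫ s in 0..u, ((∫ r in 0..v, (1 - p (y - s) (y + r))) +
          v * ((1 - p (y - s) y) + (1 - rightMean p y v))) :=
        intervalIntegral.integral_mono_on hu.le
          (((hp.isBoundedMeasurable_abs_mulDefect y).intervalIntegral 0 v).intervalIntegrable 0 u)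
          (both_integrable.add rest_integrable)
          fun s _ => hp.integral_abs_mulDefect_right_le y s hv
    _ = (∫ s in 0..u, ∫ r in 0..v, (1 - p (y - s) (y + r))) +
          u * v * ((1 - rightMean (RandomHomeo.reflect p) (-y) u) + (1 - rightMean p y v)) := by
        rw [intervalIntegral.integral_add both_integrable rest_integrable,
          intervalIntegral.integral_const_mul,
          intervalIntegral.integral_add left_integrable intervalIntegrable_const,
          left_integral, intervalIntegral.integral_const, smul_eq_mul]
        ring
    _ ≤ _ := add_le_add_left (hp.integral_one_sub_le hu huv hη) _

theorem hasVanishingMeans_of_rightLimit_eq_zero {y : ℝ} (hy : rightLimit p y = 0)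
    (lebesgue : ∀ ε > 0, ∃ δ > 0, ∀ h ∈ Ioo 0 δ, ∫ t in (y - h)..y, rightLimit p t ≤ h * ε) :
    HasVanishingMeans fun u v => |mulDefect p y u v| := by
  refine fun ε hε => (lebesgue ε hε).imp fun δ ⟨hδ, mean_le⟩ => ⟨hδ, fun u v hu huv hv => ?_⟩
  have v_pos : 0 < v := hu.trans_le huv
  have abs_le_rightLimit {s r : ℝ} (hs : 0 < s) (hr : 0 < r) :
      |mulDefect p y s r| ≤ rightLimit p (y - s) := by
    have right_eq_zero : p y (y + r) = 0 :=
      le_antisymm (hy ▸ hp.le_rightLimit (lt_add_of_pos_right y hr)) (hp.nonneg _ _)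
    rw [mulDefect, right_eq_zero, mul_zero, sub_zero, abs_of_nonneg (hp.nonneg _ _)]
    exact hp.le_rightLimit (by linarith)
  have bounded := hp.isBoundedMeasurable_abs_mulDefect y
  have row_le {s : ℝ} (hs : 0 < s) :
      ∫ r in 0..v, |mulDefect p y s r| ≤ v * rightLimit p (y - s) := by
    simpa only [sub_zero] using intervalIntegral_le_mul v_pos.le
      ((bounded.section_right s).intervalIntegrable 0 v) fun r hr => abs_le_rightLimit hs hr.1
  calc ∫ s in 0..u, ∫ r in 0..v, |mulDefect p y s r|
      ≤ ∫ s in 0..u, v * rightLimit p (y - s) :=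
        intervalIntegral.integral_mono_on_of_le_Ioo hu.le
          ((bounded.intervalIntegral 0 v).intervalIntegrable 0 u)
          (((hp.isBoundedMeasurable_rightLimit.comp
            (measurable_id.const_sub y)).intervalIntegrable 0 u).const_mul v)
          fun s hs => row_le hs.1
    _ = v * ∫ t in (y - u)..y, rightLimit p t := by
        rw [intervalIntegral.integral_const_mul,
          intervalIntegral.integral_comp_sub_left (rightLimit p), sub_zero]
    _ ≤ v * (u * ε) := by
        gcongr
        exact mean_le u ⟨hu, by linarith⟩
    _ = ε * (u * v) := by ring

theorem hasVanishingMeans_of_rightLimit_eq_one {y : ℝ} (hy : rightLimit p y = 1)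
    (hy' : rightLimit (RandomHomeo.reflect p) (-y) = 1)
    (lebesgue : ∀ n : ℕ, ∀ ε > 0, ∃ δ > 0, ∀ h ∈ Ioo 0 δ,
      ∫ t in (y - h)..y, (1 - rightMean p t (1 / ((n : ℝ) + 1))) ≤
        h * ((1 - rightMean p y (1 / ((n : ℝ) + 1))) + ε)) :
    HasVanishingMeans fun u v => |mulDefect p y u v| := by
  intro ε hε
  obtain ⟨n, right_lt⟩ := hp.exists_forall_rightLimit_sub_lt y (show 0 < ε / 6 by positivity)
  obtain ⟨m, left_lt⟩ :=
    hp.reflect.exists_forall_rightLimit_sub_lt (-y) (show 0 < ε / 6 by positivity)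
  obtain ⟨δ, hδ, mean_le⟩ := lebesgue n (ε / 6) (by positivity)
  rw [hy] at right_lt
  rw [hy'] at left_lt
  have hn : (0 : ℝ) < 1 / ((n : ℝ) + 1) := by positivity
  refine ⟨min δ (min (1 / ((n : ℝ) + 1) / 2) (1 / ((m : ℝ) + 1))), by positivity,
    fun u v hu huv hv => ?_⟩
  obtain ⟨hvδ, hvn, hvm⟩ : v < δ ∧ v < 1 / ((n : ℝ) + 1) / 2 ∧ v < 1 / ((m : ℝ) + 1) := by
    simpa only [lt_min_iff] using hv
  have v_pos : 0 < v := hu.trans_le huv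
  calc ∫ s in 0..u, ∫ r in 0..v, |mulDefect p y s r|
      ≤ (2 * v * ∫ t in (y - u)..y, (1 - rightMean p t (1 / ((n : ℝ) + 1)))) +
        u * v * ((1 - rightMean (RandomHomeo.reflect p) (-y) u) + (1 - rightMean p y v)) :=
        hp.integral_abs_mulDefect_le hu huv (by linarith)
    _ ≤ 2 * v * (u * (ε / 6 + ε / 6)) + u * v * (ε / 6 + ε / 6) := by
        gcongr
        · refine (mean_le u ⟨hu, huv.trans_lt hvδ⟩).trans ?_
          gcongr
          linarith [right_lt _ ⟨hn, le_rfl⟩]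
        · linarith [left_lt u ⟨hu, by linarith⟩]
        · linarith [right_lt v ⟨v_pos, by linarith⟩]
    _ = ε * (u * v) := by ring

theorem ae_hasVanishingMeans_abs_mulDefect :
    ∀ᵐ y, HasVanishingMeans fun u v => |mulDefect p y u v| := by
  have bounded (n : ℕ) : IsBoundedMeasurable fun t => 1 - rightMean p t (1 / ((n : ℝ) + 1)) :=
    (IsBoundedMeasurable.const 1).sub (hp.isBoundedMeasurable_rightMean (by positivity))
  filter_upwards [hp.ae_rightLimit_eq_zero_or_one, hp.ae_rightLimit_le_rightLimit_reflect,
    hp.isBoundedMeasurable_rightLimit.ae_integral_le_mul_add,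
    ae_all_iff.2 fun n => (bounded n).ae_integral_le_mul_add]
    with y zero_or_one le_reflect limit_lebesgue mean_lebesgue
  rcases zero_or_one with hy | hy
  · refine hp.hasVanishingMeans_of_rightLimit_eq_zero hy fun ε hε => ?_
    exact (limit_lebesgue ε hε).imp fun δ hδ =>
      ⟨hδ.1, fun h hh => (hδ.2 h hh).1.trans_eq (by rw [hy, zero_add])⟩
  · refine hp.hasVanishingMeans_of_rightLimit_eq_one hy
      ((hp.reflect.rightLimit_le_one _).antisymm (hy ▸ le_reflect)) fun n ε hε => ?_
    exact (mean_lebesgue n ε hε).imp fun δ hδ => ⟨hδ.1, fun h hh => (hδ.2 h hh).1⟩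

theorem ae_mulDefect_eq_zero : ∀ᵐ y, ∀ u v, 0 < u → 0 < v → mulDefect p y u v = 0 := by
  have ae_swap : ∀ᵐ y : ℝ, HasVanishingMeans fun u v => |mulDefect p y v u| := by
    filter_upwards [(Measure.measurePreserving_neg volume).quasiMeasurePreserving.ae
      hp.reflect.ae_hasVanishingMeans_abs_mulDefect] with y hy
    simpa only [mulDefect_reflect] using hy
  filter_upwards [hp.ae_hasVanishingMeans_abs_mulDefect, ae_swap] with y hy hy' u v hu hv
  exact abs_eq_zero.1 ((hp.isSubharmonic_abs_mulDefect y).eq_zero (fun _ _ => abs_nonneg _)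
    hy hy' hu hv)

theorem ae_eq_mul : ∀ᵐ y, ∀ x z, x < y → y < z → p x z = p x y * p y z := by
  filter_upwards [hp.ae_mulDefect_eq_zero] with y hy x z hxy hyz
  simpa only [mulDefect, sub_sub_cancel, add_sub_cancel, sub_eq_zero] using
    hy (y - x) (z - y) (sub_pos.2 hxy) (sub_pos.2 hyz)

end IsSelfAveraging

end Multiplicativity

section Triangle

theorem measurableSet_triangle : MeasurableSet triangle :=
  ((isClosed_le continuous_const continuous_fst).inter
    ((isClosed_le continuous_fst continuous_snd).inter
      (isClosed_le continuous_snd continuous_const))).measurableSet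

theorem exists_measurableSet_forall_ae_and_ae {α : Type*} [MeasurableSpace α] {μ : Measure α}
    [SFinite μ] {R : α → α → Prop} (hR : ∀ᵐ q ∂μ.prod μ, R q.1 q.2) :
    ∃ G, MeasurableSet G ∧ (∀ᵐ x ∂μ, x ∈ G) ∧
      ∀ x ∈ G, (∀ᵐ t ∂μ, R x t) ∧ ∀ᵐ t ∂μ, R t x := by
  have ae_right : ∀ᵐ x ∂μ, ∀ᵐ t ∂μ, R x t := Measure.ae_ae_of_ae_prod hR
  have ae_left : ∀ᵐ x ∂μ, ∀ᵐ t ∂μ, R t x := Measure.ae_ae_of_ae_prod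
    (Measure.measurePreserving_swap.quasiMeasurePreserving.ae hR)
  obtain ⟨G, ae_mem, measurable_G, forall_mem⟩ := (ae_right.and ae_left).exists_measurable_mem
  exact ⟨G, measurable_G, ae_mem, forall_mem⟩

/-- The mean of `q x t * q t y` over `t ∈ [x, y]`, rescaled to an integral over `[0, 1]` so that it
is manifestly measurable in `(x, y)`. -/
noncomputable def intervalAverage (q : ℝ → ℝ → ℝ) (x y : ℝ) : ℝ :=
  ∫ s in 0..1, q x (x + (y - x) * s) * q (x + (y - x) * s) y

theorem mul_intervalAverage (q : ℝ → ℝ → ℝ) (x y : ℝ) :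
    (y - x) * intervalAverage q x y = ∫ t in x..y, q x t * q t y := by
  have rescale := intervalIntegral.smul_integral_comp_add_mul (a := 0) (b := 1)
    (fun t => q x t * q t y) (y - x) x
  rwa [mul_zero, add_zero, mul_one, add_sub_cancel, smul_eq_mul] at rescale

theorem measurable_intervalAverage {q : ℝ → ℝ → ℝ} (hq : Measurable (Function.uncurry q)) :
    Measurable (Function.uncurry (intervalAverage q)) := by
  have measurable_integrand : Measurable fun r : (ℝ × ℝ) × ℝ =>
      q r.1.1 (r.1.1 + (r.1.2 - r.1.1) * r.2) * q (r.1.1 + (r.1.2 - r.1.1) * r.2) r.1.2 :=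
    (hq.comp (f := fun r : (ℝ × ℝ) × ℝ => (r.1.1, r.1.1 + (r.1.2 - r.1.1) * r.2))
      (by fun_prop)).mul
    (hq.comp (f := fun r : (ℝ × ℝ) × ℝ => (r.1.1 + (r.1.2 - r.1.1) * r.2, r.1.2)) (by fun_prop))
  simp only [Function.uncurry_def, intervalAverage, intervalIntegral.integral_of_le zero_le_one]
  exact measurable_integrand.stronglyMeasurable.integral_prod_right.measurable

theorem intervalAverage_mem_Icc {q : ℝ → ℝ → ℝ} (hq : ∀ x y, q x y ∈ Icc (0 : ℝ) 1) (x y : ℝ) :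
    intervalAverage q x y ∈ Icc (0 : ℝ) 1 := by
  have mem_Icc (s : ℝ) : q x (x + (y - x) * s) * q (x + (y - x) * s) y ∈ Icc (0 : ℝ) 1 :=
    ⟨mul_nonneg (hq _ _).1 (hq _ _).1, mul_le_one₀ (hq _ _).2 (hq _ _).1 (hq _ _).2⟩
  refine ⟨intervalIntegral.integral_nonneg zero_le_one fun s _ => (mem_Icc s).1, ?_⟩
  have norm_le := intervalIntegral.norm_integral_le_of_norm_le_const (a := 0) (b := 1) (C := 1)
    fun s _ => (Real.norm_of_nonneg (mem_Icc s).1).trans_le (mem_Icc s).2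
  rw [sub_zero, abs_one, mul_one] at norm_le
  exact (Real.le_norm_self _).trans norm_le

theorem exists_measurable_ae_eq_of_mem_Icc {p : ℝ → ℝ → ℝ}
    (hm : AEMeasurable (fun q : ℝ × ℝ => p q.1 q.2) (volume.restrict triangle))
    (hp : ∀ x y : ℝ, 0 ≤ x → x ≤ y → y ≤ 1 → p x y ∈ Icc (0 : ℝ) 1) :
    ∃ q : ℝ → ℝ → ℝ, Measurable (Function.uncurry q) ∧ (∀ x y, q x y ∈ Icc (0 : ℝ) 1) ∧
      ∀ᵐ r : ℝ × ℝ, r ∈ triangle → p r.1 r.2 = q r.1 r.2 := by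
  have ae_mem_Icc : ∀ᵐ r ∂volume.restrict triangle, p r.1 r.2 ∈ Icc (0 : ℝ) 1 :=
    (ae_restrict_mem measurableSet_triangle).mono fun r hr => hp r.1 r.2 hr.1 hr.2.1 hr.2.2
  obtain ⟨q, measurable_q, range_q, ae_eq⟩ :=
    hm.exists_ae_eq_range_subset ae_mem_Icc ⟨0, left_mem_Icc.2 zero_le_one⟩
  exact ⟨fun x y => q (x, y), measurable_q, fun x y => range_q (mem_range_self _),
    (ae_restrict_iff' measurableSet_triangle).1 ae_eq⟩

theorem intervalAverage_eq_of_ae_eq {p q : ℝ → ℝ → ℝ} {x y : ℝ} (hxy : x < y)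
    (heq : p x y = 1 / (y - x) * ∫ t in x..y, p x t * p t y)
    (hx : ∀ᵐ t, t ∈ Ioc x y → p x t = q x t) (hy : ∀ᵐ t, t ∈ Ioc x y → p t y = q t y) :
    intervalAverage q x y = p x y := by
  have integral_eq : ∫ t in x..y, q x t * q t y = ∫ t in x..y, p x t * p t y := by
    refine intervalIntegral.integral_congr_ae ?_
    filter_upwards [hx, hy] with t eq_right eq_left ht
    rw [uIoc_of_le hxy.le] at ht
    rw [eq_right ht, eq_left ht]
  rw [heq, ← integral_eq, ← mul_intervalAverage, ← mul_assoc,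
    one_div_mul_cancel (sub_pos.2 hxy).ne', one_mul]

theorem exists_isSelfAveraging_of_intervalAverage_eq {p q : ℝ → ℝ → ℝ} {G : Set ℝ}
    (hqm : Measurable (Function.uncurry q)) (hq : ∀ x y, q x y ∈ Icc (0 : ℝ) 1)
    (hGm : MeasurableSet G) (hG : ∀ x ∈ G, ∀ y ∈ G, ∀ᵐ t, t ∈ Ioc x y → t ∈ G)
    (heq : ∀ x ∈ G, ∀ y ∈ G, x < y → p x y = 1 / (y - x) * ∫ t in x..y, p x t * p t y)
    (havg : ∀ x ∈ G, ∀ y ∈ G, x < y → intervalAverage q x y = p x y) :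
    ∃ p' : ℝ → ℝ → ℝ, IsSelfAveraging p' ∧ ∀ x ∈ G, ∀ y ∈ G, x < y → p' x y = p x y := by
  set S : Set (ℝ × ℝ) := {r | r.1 ∈ G ∧ r.2 ∈ G ∧ r.1 < r.2}
  have measurable_S : MeasurableSet S := (measurable_fst hGm).inter
    ((measurable_snd hGm).inter (measurableSet_lt measurable_fst measurable_snd))
  set p' : ℝ → ℝ → ℝ := fun x y => S.indicator (Function.uncurry (intervalAverage q)) (x, y)
  have agree (x) (hx : x ∈ G) (y) (hy : y ∈ G) (hxy : x < y) : p' x y = p x y :=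
    (indicator_of_mem (show (x, y) ∈ S from ⟨hx, hy, hxy⟩) _).trans (havg x hx y hy hxy)
  have eq_zero_left (x y) (hx : x ∉ G) : p' x y = 0 := indicator_of_notMem (fun h => hx h.1) _
  have eq_zero_right (x y) (hy : y ∉ G) : p' x y = 0 := indicator_of_notMem (fun h => hy h.2.1) _
  refine ⟨p', ⟨(measurable_intervalAverage hqm).indicator measurable_S,
    fun x y => indicator_nonneg (fun r _ => (intervalAverage_mem_Icc hq r.1 r.2).1) _,
    fun x y => indicator_apply_le' (fun _ => (intervalAverage_mem_Icc hq x y).2)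
      fun _ => zero_le_one, fun x y hxy => ?_⟩, agree⟩
  by_cases hx : x ∈ G
  · by_cases hy : y ∈ G
    · have ae_ne : ∀ᵐ t : ℝ, t ≠ y := by simp [ae_iff]
      rw [agree x hx y hy hxy, heq x hx y hy hxy, ← mul_assoc,
        mul_one_div_cancel (sub_pos.2 hxy).ne', one_mul]
      refine intervalIntegral.integral_congr_ae ?_
      filter_upwards [hG x hx y hy, ae_ne] with t mem_G ne_y ht
      rw [uIoc_of_le hxy.le] at ht
      rw [agree x hx t (mem_G ht) ht.1, agree t (mem_G ht) y hy (ht.2.lt_of_ne ne_y)]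
    · simp only [eq_zero_right _ y hy, mul_zero, intervalIntegral.integral_zero]
  · simp only [eq_zero_left x _ hx, mul_zero, zero_mul, intervalIntegral.integral_zero]

/-- The equation holds everywhere on the triangle while `p` is only almost everywhere measurable;
it therefore determines `p` on a product `G × G` from a Borel version of `p`. -/
theorem exists_isSelfAveraging {p : ℝ → ℝ → ℝ}
    (hm : AEMeasurable (fun q : ℝ × ℝ => p q.1 q.2) (volume.restrict triangle))
    (hp : ∀ x y : ℝ, 0 ≤ x → x ≤ y → y ≤ 1 → p x y ∈ Icc (0 : ℝ) 1)
    (heq : ∀ x y : ℝ, 0 ≤ x → x < y → y ≤ 1 →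
      p x y = 1 / (y - x) * ∫ t in x..y, p x t * p t y) :
    ∃ (G : Set ℝ) (p' : ℝ → ℝ → ℝ), (∀ᵐ x, x ∈ Icc (0 : ℝ) 1 → x ∈ G) ∧ IsSelfAveraging p' ∧
      ∀ x ∈ G, ∀ y ∈ G, x < y → p' x y = p x y := by
  obtain ⟨q, measurable_q, q_mem_Icc, ae_eq⟩ := exists_measurable_ae_eq_of_mem_Icc hm hp
  rw [Measure.volume_eq_prod] at ae_eq
  obtain ⟨H, measurable_H, ae_mem_H, sections⟩ :=
    exists_measurableSet_forall_ae_and_ae (R := fun x y => (x, y) ∈ triangle → p x y = q x y) ae_eq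
  have average_eq (x) (hx : x ∈ H ∩ Icc 0 1) (y) (hy : y ∈ H ∩ Icc 0 1) (hxy : x < y) :
      intervalAverage q x y = p x y :=
    intervalAverage_eq_of_ae_eq hxy (heq x y hx.2.1 hxy hy.2.2)
      ((sections x hx.1).1.mono fun t h ht => h ⟨hx.2.1, ht.1.le, ht.2.trans hy.2.2⟩)
      ((sections y hy.1).2.mono fun t h ht => h ⟨hx.2.1.trans ht.1.le, ht.2, hy.2.2⟩)
  obtain ⟨p', self_averaging, agree⟩ := exists_isSelfAveraging_of_intervalAverage_eq
    measurable_q q_mem_Icc (measurable_H.inter measurableSet_Icc)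
    (fun x hx y hy => ae_mem_H.mono fun t mem_H ht =>
      ⟨mem_H, hx.2.1.trans ht.1.le, ht.2.trans hy.2.2⟩)
    (fun x hx y hy hxy => heq x y hx.2.1 hxy hy.2.2) average_eq
  exact ⟨H ∩ Icc 0 1, p', ae_mem_H.mono fun x mem_H hx => ⟨mem_H, hx⟩, self_averaging, agree⟩

theorem ae_eq_mul_of_eq_integral {p : ℝ → ℝ → ℝ}
    (hm : AEMeasurable (fun q : ℝ × ℝ => p q.1 q.2) (volume.restrict triangle))
    (hp : ∀ x y : ℝ, 0 ≤ x → x ≤ y → y ≤ 1 → 0 ≤ p x y ∧ p x y ≤ 1)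
    (heq : ∀ x y : ℝ, 0 ≤ x → x < y → y ≤ 1 →
      p x y = 1 / (y - x) * ∫ t in x..y, p x t * p t y) :
    ∀ᵐ q : ℝ × ℝ × ℝ, 0 ≤ q.1 → q.1 < q.2.1 → q.2.1 < q.2.2 → q.2.2 ≤ 1 →
      p q.1 q.2.2 ≤ p q.1 q.2.1 ∧ p q.1 q.2.2 ≤ p q.2.1 q.2.2 ∧
        p q.1 q.2.2 = p q.1 q.2.1 * p q.2.1 q.2.2 := by
  obtain ⟨G, p', ae_mem_G, hp', agree⟩ := exists_isSelfAveraging hm hp heq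
  rw [Measure.volume_eq_prod, Measure.volume_eq_prod]
  have ae_fst := (Measure.quasiMeasurePreserving_fst (μ := (volume : Measure ℝ))
    (ν := (volume : Measure ℝ).prod (volume : Measure ℝ))).ae ae_mem_G
  have snd_qmp := Measure.quasiMeasurePreserving_snd (μ := (volume : Measure ℝ))
    (ν := (volume : Measure ℝ).prod (volume : Measure ℝ))
  have ae_middle := snd_qmp.ae ((Measure.quasiMeasurePreserving_fst (μ := (volume : Measure ℝ))
    (ν := (volume : Measure ℝ))).ae (ae_mem_G.and hp'.ae_eq_mul))
  have ae_last := snd_qmp.ae ((Measure.quasiMeasurePreserving_snd (μ := (volume : Measure ℝ))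
    (ν := (volume : Measure ℝ))).ae ae_mem_G)
  filter_upwards [ae_fst, ae_middle, ae_last] with ⟨x, y, z⟩ hxG ⟨hyG, mul_eq⟩ hzG hx hxy hyz hz
  dsimp only at *
  replace hxG := hxG ⟨hx, by linarith⟩
  replace hyG := hyG ⟨by linarith, by linarith⟩
  replace hzG := hzG ⟨by linarith, hz⟩
  replace mul_eq := mul_eq x z hxy hyz
  rw [agree x hxG z hzG (hxy.trans hyz), agree x hxG y hyG hxy, agree y hyG z hzG hyz] at mul_eq
  obtain ⟨xy_nonneg, xy_le_one⟩ := hp x y hx hxy.le (by linarith)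
  obtain ⟨yz_nonneg, yz_le_one⟩ := hp y z (by linarith) hyz.le hz
  exact ⟨mul_eq ▸ mul_le_of_le_one_right xy_nonneg yz_le_one,
    mul_eq ▸ mul_le_of_le_one_left yz_nonneg xy_le_one, mul_eq⟩

end Triangle

section ProductMeasure

variable {ι α β : Type*} {Ω : ι → Type*} [∀ i, MeasurableSpace (Ω i)] {P : ∀ i, Measure (Ω i)}
  [∀ i, IsProbabilityMeasure (P i)] {f : α → ι} {g : β → ι}

theorem comap_comp_le_iSup_comap_eval (f : α → ι) :
    MeasurableSpace.pi.comap (fun (w : ∀ i, Ω i) a => w (f a)) ≤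
      ⨆ i ∈ range f, MeasurableSpace.comap (fun w : ∀ i, Ω i => w i) inferInstance := by
  simp only [MeasurableSpace.pi, MeasurableSpace.comap_iSup, MeasurableSpace.comap_comp]
  exact iSup_le fun a => le_iSup₂_of_le (f a) (mem_range_self a) le_rfl

theorem indepFun_comp_of_disjoint_range (hfg : Disjoint (range f) (range g)) :
    IndepFun (fun (w : ∀ i, Ω i) a => w (f a)) (fun w b => w (g b)) (Measure.infinitePi P) := by
  have indep_eval : iIndep (fun i => MeasurableSpace.comap (fun w : ∀ i, Ω i => w i) inferInstance)
      (Measure.infinitePi P) :=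
    (iIndepFun_infinitePi (P := P) (X := fun _ x => x) fun _ => measurable_id).iIndep
  have indep_ranges := indep_iSup_of_disjoint (fun i => (measurable_pi_apply i).comap_le)
    indep_eval hfg
  exact (IndepFun_iff_Indep _ _ _).2 (indep_of_indep_of_le_left
    (indep_of_indep_of_le_right indep_ranges (comap_comp_le_iSup_comap_eval g))
    (comap_comp_le_iSup_comap_eval f))

theorem measurePreserving_infinitePi_prodMk (hf : Function.Injective f)
    (hg : Function.Injective g) (hfg : Disjoint (range f) (range g)) :
    MeasurePreserving (fun (w : ∀ i, Ω i) => (fun a => w (f a), fun b => w (g b)))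
      (Measure.infinitePi P)
      ((Measure.infinitePi fun a => P (f a)).prod (Measure.infinitePi fun b => P (g b))) := by
  refine ⟨by fun_prop, ?_⟩
  rw [(indepFun_comp_of_disjoint_range hfg).map_prod_eq_prod_map_map
      (measurable_pi_lambda _ fun _ => measurable_pi_apply _).aemeasurable
      (measurable_pi_lambda _ fun _ => measurable_pi_apply _).aemeasurable,
    Measure.map_infinitePi_infinitePi_of_inj hf, Measure.map_infinitePi_infinitePi_of_inj hg]

theorem infinitePi_eq_zero_or_one_of_inter_pi {A : Set (∀ i, Ω i)}
    (hA : ∀ (s : Finset ι) (t : ∀ i, Set (Ω i)), (∀ i, MeasurableSet (t i)) →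
      Measure.infinitePi P (A ∩ (s : Set ι).pi t) =
        Measure.infinitePi P A * Measure.infinitePi P ((s : Set ι).pi t)) :
    Measure.infinitePi P A = 0 ∨ Measure.infinitePi P A = 1 := by
  refine or_iff_not_imp_left.2 fun ne_zero => ?_
  have inv_mul : (Measure.infinitePi P A)⁻¹ * Measure.infinitePi P A = 1 :=
    ENNReal.inv_mul_cancel ne_zero (measure_ne_top _ _)
  have cond_eq : (Measure.infinitePi P A)⁻¹ • (Measure.infinitePi P).restrict A =
      Measure.infinitePi P := by
    refine Measure.eq_infinitePi _ fun s t ht => ?_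
    rw [Measure.smul_apply,
      Measure.restrict_apply (MeasurableSet.pi s.countable_toSet fun i _ => ht i), smul_eq_mul,
      inter_comm, hA s t ht, ← mul_assoc, inv_mul, one_mul]
    exact Measure.infinitePi_pi _ fun i _ => ht i
  rw [← inv_mul]
  conv_lhs => rw [← cond_eq]
  rw [Measure.smul_apply, Measure.restrict_apply_self, smul_eq_mul]

end ProductMeasure

section Nodes

/-- The index set of the random variables used by `dyadicValue`: the nodes `(n, k)`, `k` odd,
`k < 2 ^ n`, of an infinite binary tree. -/
abbrev Node : Type := {q : ℕ × ℕ // Odd q.2 ∧ q.2 < 2 ^ q.1}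

namespace Node

/-- The root `(1, 1)`, which corresponds to the point `1 / 2`. -/
def root : Node := ⟨(1, 1), odd_one, by norm_num⟩

/-- The node corresponding to `j` in the left half of the tree. -/
def left (j : Node) : Node :=
  ⟨(j.1.1 + 1, j.1.2), j.2.1, j.2.2.trans (Nat.pow_lt_pow_succ one_lt_two)⟩

theorem level_pos (j : Node) : 0 < j.1.1 := by
  obtain ⟨⟨n, k⟩, k_odd, k_lt⟩ := j
  rcases Nat.eq_zero_or_pos n with rfl | n_pos
  · exact absurd k_odd.pos (by simpa using k_lt)
  · exact n_pos

/-- The node corresponding to `j` in the right half of the tree. -/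
def right (j : Node) : Node :=
  ⟨(j.1.1 + 1, 2 ^ j.1.1 + j.1.2),
    (Even.pow_of_ne_zero even_two j.level_pos.ne').add_odd j.2.1, by
      rw [pow_succ, mul_two]
      exact Nat.add_lt_add_left j.2.2 _⟩

theorem left_injective : Function.Injective left := by
  rintro ⟨⟨n, k⟩, _⟩ ⟨⟨m, l⟩, _⟩ h
  simp_all [left]

theorem right_injective : Function.Injective right := by
  rintro ⟨⟨n, k⟩, _⟩ ⟨⟨m, l⟩, _⟩ h
  obtain ⟨rfl, h⟩ : n = m ∧ 2 ^ n + k = 2 ^ m + l := by simpa [right] using h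
  simpa using h

theorem left_ne_root (j : Node) : left j ≠ root := fun h =>
  j.level_pos.ne' (Nat.succ_injective (congrArg (fun i : Node => i.1.1) h))

theorem right_ne_root (j : Node) : right j ≠ root := fun h =>
  j.level_pos.ne' (Nat.succ_injective (congrArg (fun i : Node => i.1.1) h))

theorem left_ne_right (i j : Node) : left i ≠ right j := by
  rcases i with ⟨⟨n, k⟩, _, k_lt⟩
  rcases j with ⟨⟨m, l⟩, _⟩
  intro h
  obtain ⟨rfl, rfl⟩ : n = m ∧ k = 2 ^ m + l := by simpa [left, right] using h
  exact (Nat.le_add_right _ _).not_gt k_lt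

theorem eq_root_or_eq_left_or_eq_right (j : Node) :
    j = root ∨ (∃ i, j = left i) ∨ ∃ i, j = right i := by
  rcases j with ⟨⟨n, k⟩, k_odd, k_lt⟩
  obtain ⟨m, rfl⟩ : ∃ m, n = m + 1 := Nat.exists_eq_add_one.2 (level_pos ⟨(n, k), k_odd, k_lt⟩)
  dsimp only at k_odd k_lt
  rcases lt_trichotomy k (2 ^ m) with lt_half | eq_half | half_lt
  · exact Or.inr (Or.inl ⟨⟨(m, k), k_odd, lt_half⟩, rfl⟩)
  · rcases eq_or_ne m 0 with rfl | m_ne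
    · exact Or.inl (Subtype.ext (by simp [root, eq_half]))
    · exact absurd (eq_half ▸ Even.pow_of_ne_zero even_two m_ne) (Nat.not_even_iff_odd.2 k_odd)
  · have m_ne : m ≠ 0 := by
      rintro rfl
      simp only [pow_zero, zero_add, pow_one] at half_lt k_lt
      omega
    have sub_odd : Odd (k - 2 ^ m) :=
      Nat.Odd.sub_even half_lt.le k_odd (Even.pow_of_ne_zero even_two m_ne)
    have sub_lt : k - 2 ^ m < 2 ^ m := by
      rw [pow_succ] at k_lt
      omega
    exact Or.inr (Or.inr ⟨⟨(m, k - 2 ^ m), sub_odd, sub_lt⟩,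
      Subtype.ext (Prod.ext rfl (Nat.add_sub_cancel' half_lt.le).symm)⟩)

end Node

/-- The uniform distribution on `[0,1]`. -/
noncomputable def unif : Measure ℝ := volume.restrict (Icc 0 1)

instance : IsProbabilityMeasure unif := ⟨by simp [unif]⟩

/-- The joint distribution of independent uniform variables indexed by the nodes. -/
noncomputable def nodeLaw : Measure (Node → ℝ) := Measure.infinitePi fun _ => unif

instance : IsProbabilityMeasure nodeLaw := by unfold nodeLaw; infer_instance

/-- The value at the root, and the values in the two halves of the tree. -/
def split (w : Node → ℝ) : ℝ × (Node → ℝ) × (Node → ℝ) :=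
  (w Node.root, fun j => w j.left, fun j => w j.right)

theorem measurePreserving_split :
    MeasurePreserving split nodeLaw (unif.prod (nodeLaw.prod nodeLaw)) := by
  have root_and_halves : MeasurePreserving
      (fun w : Node → ℝ =>
        (fun _ : Unit => w Node.root, fun i => w (Sum.elim Node.left Node.right i)))
      nodeLaw ((Measure.infinitePi fun _ => unif).prod (Measure.infinitePi fun _ => unif)) :=
    measurePreserving_infinitePi_prodMk (Function.injective_of_subsingleton fun _ => Node.root)
      (Node.left_injective.sumElim Node.right_injective Node.left_ne_right)
      (by simp [Node.left_ne_root, Node.right_ne_root])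
  have halves : MeasurePreserving (fun w : Node ⊕ Node → ℝ => (w ∘ Sum.inl, w ∘ Sum.inr))
      (Measure.infinitePi fun _ => unif) (nodeLaw.prod nodeLaw) :=
    measurePreserving_infinitePi_prodMk Sum.inl_injective Sum.inr_injective
      isCompl_range_inl_range_inr.disjoint
  exact ((measurePreserving_eval_infinitePi (fun _ => unif) ()).prod halves).comp root_and_halves

theorem IsUniformFamily.measurePreserving_nodeLaw {Ω : Type*} [MeasurableSpace Ω] {P : Measure Ω}
    {X : ℕ → ℕ → Ω → ℝ} (hX : IsUniformFamily P X) :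
    MeasurePreserving (fun ω (j : Node) => X j.1.1 j.1.2 ω) P nodeLaw := by
  have measurable_X (j : Node) : Measurable (X j.1.1 j.1.2) := hX.measurable _ _ j.2.1 j.2.2
  have map_X (j : Node) : P.map (X j.1.1 j.1.2) = unif := by
    rw [hX.uniform _ _ j.2.1 j.2.2, ProbabilityTheory.cond, Real.volume_Icc, sub_zero,
      ENNReal.ofReal_one, inv_one, one_smul, unif]
  refine ⟨measurable_pi_lambda _ measurable_X, ?_⟩
  rw [hX.indep.map_fun_eq_infinitePi_map measurable_X, nodeLaw]
  simp only [map_X]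

end Nodes

section DyadicValues

variable {ξ ξ' : ℕ → ℕ → ℝ}

theorem dyadicValue_even (ξ : ℕ → ℕ → ℝ) (n k : ℕ) :
    dyadicValue ξ (n + 1) (2 * k) = dyadicValue ξ n k := by
  rw [dyadicValue, if_pos (even_two_mul k), Nat.mul_div_cancel_left _ two_pos]

theorem dyadicValue_odd (ξ : ℕ → ℕ → ℝ) (n k : ℕ) :
    dyadicValue ξ (n + 1) (2 * k + 1) = dyadicValue ξ n k +
      ξ (n + 1) (2 * k + 1) * (dyadicValue ξ n (k + 1) - dyadicValue ξ n k) := by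
  have half : (2 * k + 1) / 2 = k := by omega
  rw [dyadicValue, if_neg (Nat.not_even_two_mul_add_one k), half]

theorem dyadicValue_zero (ξ : ℕ → ℕ → ℝ) (n : ℕ) : dyadicValue ξ n 0 = 0 := by
  induction n with
  | zero => exact Nat.cast_zero
  | succ n ih => exact (dyadicValue_even ξ n 0).trans ih

theorem dyadicValue_mul_two_pow (ξ : ℕ → ℕ → ℝ) (n m k : ℕ) :
    dyadicValue ξ (n + m) (2 ^ m * k) = dyadicValue ξ n k := by
  induction m with
  | zero => rw [add_zero, pow_zero, one_mul]
  | succ m ih => rw [← add_assoc, pow_succ', mul_assoc, dyadicValue_even, ih]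

theorem dyadicValue_two_pow (ξ : ℕ → ℕ → ℝ) (n : ℕ) : dyadicValue ξ n (2 ^ n) = 1 := by
  simpa [dyadicValue] using dyadicValue_mul_two_pow ξ 0 n 1

theorem dyadicValue_congr (h : ∀ n k, Odd k → k < 2 ^ n → ξ n k = ξ' n k) (n : ℕ) :
    ∀ k ≤ 2 ^ n, dyadicValue ξ n k = dyadicValue ξ' n k := by
  induction n with
  | zero => exact fun k _ => rfl
  | succ n ih =>
    intro k hk
    rw [pow_succ] at hk
    rcases Nat.even_or_odd' k with ⟨m, rfl | rfl⟩
    · rw [dyadicValue_even, dyadicValue_even, ih m (by omega)]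
    · rw [dyadicValue_odd, dyadicValue_odd, ih m (by omega), ih (m + 1) (by omega),
        h _ _ (odd_two_mul_add_one m) (by rw [pow_succ]; omega)]

theorem dyadicValue_left (ξ : ℕ → ℕ → ℝ) (n : ℕ) : ∀ k ≤ 2 ^ n,
    dyadicValue ξ (n + 1) k = ξ 1 1 * dyadicValue (fun n k => ξ (n + 1) k) n k := by
  induction n with
  | zero =>
    intro k hk
    rcases Nat.le_one_iff_eq_zero_or_eq_one.1 hk with rfl | rfl <;> simp [dyadicValue]
  | succ n ih =>
    intro k hk
    rw [pow_succ] at hk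
    rcases Nat.even_or_odd' k with ⟨m, rfl | rfl⟩
    · rw [dyadicValue_even, dyadicValue_even, ih m (by omega)]
    · rw [dyadicValue_odd, dyadicValue_odd, ih m (by omega), ih (m + 1) (by omega)]
      ring

theorem dyadicValue_right (ξ : ℕ → ℕ → ℝ) (n : ℕ) : ∀ k ≤ 2 ^ n,
    dyadicValue ξ (n + 1) (2 ^ n + k) =
      ξ 1 1 + (1 - ξ 1 1) * dyadicValue (fun n k => ξ (n + 1) (2 ^ n + k)) n k := by
  induction n with
  | zero =>
    intro k hk
    rcases Nat.le_one_iff_eq_zero_or_eq_one.1 hk with rfl | rfl <;> simp [dyadicValue]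
  | succ n ih =>
    intro k hk
    rw [pow_succ] at hk
    rcases Nat.even_or_odd' k with ⟨m, rfl | rfl⟩
    · rw [pow_succ', ← mul_add, dyadicValue_even, dyadicValue_even, ih m (by omega)]
    · have index_eq : 2 * (2 ^ n + m) + 1 = 2 ^ (n + 1) + (2 * m + 1) := by ring
      rw [← index_eq, dyadicValue_odd, dyadicValue_odd, ih m (by omega),
        add_assoc (2 ^ n) m 1, ih (m + 1) (by omega), index_eq]
      ring

end DyadicValues

section DyadicPoints

theorem natCast_div_two_pow_le_one_iff {n k : ℕ} : (k : ℝ) / 2 ^ n ≤ 1 ↔ k ≤ 2 ^ n := by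
  rw [div_le_one (by positivity)]
  norm_cast

theorem floor_mul_two_pow_le {x : ℝ} (hx : x ≤ 1) (n : ℕ) : ⌊x * 2 ^ n⌋₊ ≤ 2 ^ n := by
  refine Nat.floor_le_of_le ?_
  push_cast
  exact mul_le_of_le_one_left (by positivity) hx

theorem floor_mul_two_pow_div_le {x : ℝ} (hx : 0 ≤ x) (n : ℕ) :
    (⌊x * 2 ^ n⌋₊ : ℝ) / 2 ^ n ≤ x := by
  rw [div_le_iff₀ (by positivity)]
  exact Nat.floor_le (by positivity)

theorem tendsto_floor_mul_two_pow_div {x : ℝ} (hx : 0 ≤ x) :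
    Tendsto (fun n : ℕ => (⌊x * 2 ^ n⌋₊ : ℝ) / 2 ^ n) atTop (𝓝 x) :=
  (tendsto_nat_floor_mul_div_atTop hx).comp (tendsto_pow_atTop_atTop_of_one_lt one_lt_two)

theorem exists_lt_dyadic_succ_lt {x y : ℝ} (hx : 0 ≤ x) (hxy : x < y) :
    ∃ n k : ℕ, x < (k : ℝ) / 2 ^ n ∧ ((k + 1 : ℕ) : ℝ) / 2 ^ n < y := by
  have length_pos : 0 < y - x := sub_pos.2 hxy
  obtain ⟨n, lt_pow⟩ := pow_unbounded_of_one_lt (2 / (y - x)) one_lt_two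
  rw [div_lt_iff₀ length_pos] at lt_pow
  have pow_pos : (0 : ℝ) < 2 ^ n := by positivity
  have floor_le := Nat.floor_le (mul_nonneg hx pow_pos.le)
  refine ⟨n, ⌊x * 2 ^ n⌋₊ + 1, ?_, ?_⟩
  · rw [lt_div_iff₀ pow_pos]
    exact_mod_cast Nat.lt_floor_add_one (x * 2 ^ n)
  · rw [div_lt_iff₀ pow_pos]
    push_cast
    linarith

end DyadicPoints

section Extension

variable {ξ : ℕ → ℕ → ℝ}

/-- The limit of the values at dyadic points increasing to `x`. For nondegenerate ratios these
values increase with the generation, so it is encoded as a supremum. -/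
noncomputable def dyadicLimit (ξ : ℕ → ℕ → ℝ) (x : ℝ) : ℝ :=
  ⨆ n : ℕ, dyadicValue ξ n ⌊x * 2 ^ n⌋₊

namespace Extends

variable {φ φ' : I ≃o I}

theorem exists_tendsto_of_le (hφ : Extends ξ φ) (x : I) :
    ∃ a : ℕ → I, Tendsto a atTop (𝓝 x) ∧ (∀ n, a n ≤ x) ∧
      ∀ n, ((φ (a n) : I) : ℝ) = dyadicValue ξ n ⌊(x : ℝ) * 2 ^ n⌋₊ := by
  have mem_I (n : ℕ) : (⌊(x : ℝ) * 2 ^ n⌋₊ : ℝ) / 2 ^ n ∈ I :=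
    ⟨by positivity, (floor_mul_two_pow_div_le x.2.1 n).trans x.2.2⟩
  exact ⟨fun n => ⟨_, mem_I n⟩, tendsto_subtype_rng.2 (tendsto_floor_mul_two_pow_div x.2.1),
    fun n => floor_mul_two_pow_div_le x.2.1 n, fun n => hφ ⟨_, mem_I n⟩ n _ rfl⟩

theorem tendsto (hφ : Extends ξ φ) (x : I) :
    Tendsto (fun n : ℕ => dyadicValue ξ n ⌊(x : ℝ) * 2 ^ n⌋₊) atTop (𝓝 (φ x : I)) := by
  obtain ⟨a, tendsto_x, -, value_eq⟩ := hφ.exists_tendsto_of_le x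
  simp only [← value_eq]
  exact (continuous_subtype_val.tendsto _).comp ((φ.continuous.tendsto x).comp tendsto_x)

theorem eq_dyadicLimit (hφ : Extends ξ φ) (x : I) : ((φ x : I) : ℝ) = dyadicLimit ξ x := by
  obtain ⟨a, -, le_x, value_eq⟩ := hφ.exists_tendsto_of_le x
  have value_le (n : ℕ) : dyadicValue ξ n ⌊(x : ℝ) * 2 ^ n⌋₊ ≤ φ x := by
    rw [← value_eq]
    exact φ.monotone (le_x n)
  exact le_antisymm (le_of_tendsto' (hφ.tendsto x)
    (le_ciSup (f := fun n : ℕ => dyadicValue ξ n ⌊(x : ℝ) * 2 ^ n⌋₊)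
      ⟨_, forall_mem_range.2 value_le⟩)) (ciSup_le value_le)

theorem unique (h : Extends ξ φ) (h' : Extends ξ φ') : φ = φ' := by
  ext x
  rw [h.eq_dyadicLimit, h'.eq_dyadicLimit]

theorem congr {ξ' : ℕ → ℕ → ℝ} (h : ∀ n k, Odd k → k < 2 ^ n → ξ n k = ξ' n k)
    (hφ : Extends ξ φ) : Extends ξ' φ := fun x n k hx =>
  (hφ x n k hx).trans
    (dyadicValue_congr h n k (natCast_div_two_pow_le_one_iff.1 (hx ▸ x.2.2)))

end Extends

/-- All division ratios lie strictly between `0` and `1`. -/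
def IsNondegenerate (ξ : ℕ → ℕ → ℝ) : Prop :=
  ∀ n k, Odd k → k < 2 ^ n → ξ n k ∈ Ioo (0 : ℝ) 1

namespace IsNondegenerate

variable (h : IsNondegenerate ξ)

include h

theorem dyadicValue_lt_succ (n : ℕ) :
    ∀ k < 2 ^ n, dyadicValue ξ n k < dyadicValue ξ n (k + 1) := by
  induction n with
  | zero =>
    intro k hk
    obtain rfl : k = 0 := Nat.lt_one_iff.1 hk
    simp [dyadicValue]
  | succ n ih =>
    intro k hk
    rw [pow_succ] at hk
    rcases Nat.even_or_odd' k with ⟨m, rfl | rfl⟩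
    all_goals
      have gap_pos := sub_pos.2 (ih m (by omega))
      obtain ⟨ratio_pos, ratio_lt_one⟩ :=
        h (n + 1) (2 * m + 1) (odd_two_mul_add_one m) (by rw [pow_succ]; omega)
    · rw [dyadicValue_even, dyadicValue_odd]
      exact lt_add_of_pos_right _ (mul_pos ratio_pos gap_pos)
    · rw [show 2 * m + 1 + 1 = 2 * (m + 1) by ring, dyadicValue_even, dyadicValue_odd]
      linarith [mul_lt_of_lt_one_left gap_pos ratio_lt_one]

theorem dyadicValue_le (n : ℕ) {j k : ℕ} (hjk : j ≤ k) (hk : k ≤ 2 ^ n) :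
    dyadicValue ξ n j ≤ dyadicValue ξ n k := by
  induction k, hjk using Nat.le_induction with
  | base => exact le_rfl
  | succ k _ ih => exact (ih (by omega)).trans (h.dyadicValue_lt_succ n k (by omega)).le

theorem dyadicValue_le_of_div_le {n m a b : ℕ} (hb : b ≤ 2 ^ m)
    (hab : (a : ℝ) / 2 ^ n ≤ (b : ℝ) / 2 ^ m) : dyadicValue ξ n a ≤ dyadicValue ξ m b := by
  rw [← dyadicValue_mul_two_pow ξ n m a, ← dyadicValue_mul_two_pow ξ m n b, add_comm m n]
  refine h.dyadicValue_le _ ?_ ?_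
  · rw [div_le_div_iff₀ (by positivity) (by positivity)] at hab
    rw [mul_comm, mul_comm _ b]
    exact_mod_cast hab
  · rw [pow_add]
    exact Nat.mul_le_mul_left _ hb

theorem dyadicValue_mem {n k : ℕ} (hk : k ≤ 2 ^ n) : dyadicValue ξ n k ∈ I :=
  ⟨(dyadicValue_zero ξ n).symm.trans_le (h.dyadicValue_le n k.zero_le hk),
    (h.dyadicValue_le n hk le_rfl).trans_eq (dyadicValue_two_pow ξ n)⟩

theorem bddAbove_dyadicValue {x : ℝ} (hx : x ≤ 1) :
    BddAbove (range fun n : ℕ => dyadicValue ξ n ⌊x * 2 ^ n⌋₊) :=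
  ⟨1, forall_mem_range.2 fun n => (h.dyadicValue_mem (floor_mul_two_pow_le hx n)).2⟩

theorem dyadicLimit_mem {x : ℝ} (hx : x ≤ 1) : dyadicLimit ξ x ∈ I :=
  ⟨(h.dyadicValue_mem (floor_mul_two_pow_le hx 0)).1.trans
      (le_ciSup (h.bddAbove_dyadicValue hx) 0),
    ciSup_le fun n => (h.dyadicValue_mem (floor_mul_two_pow_le hx n)).2⟩

theorem dyadicLimit_le {x y : ℝ} (hxy : x ≤ y) (hy : y ≤ 1) : dyadicLimit ξ x ≤ dyadicLimit ξ y :=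
  ciSup_mono (h.bddAbove_dyadicValue hy) fun n =>
    h.dyadicValue_le n (by gcongr) (floor_mul_two_pow_le hy n)

theorem dyadicLimit_natCast_div {n k : ℕ} (hk : k ≤ 2 ^ n) :
    dyadicLimit ξ ((k : ℝ) / 2 ^ n) = dyadicValue ξ n k := by
  refine le_antisymm (ciSup_le fun m =>
    h.dyadicValue_le_of_div_le hk (floor_mul_two_pow_div_le (by positivity) m)) ?_
  have value_le := le_ciSup (h.bddAbove_dyadicValue (natCast_div_two_pow_le_one_iff.2 hk)) n
  rwa [div_mul_cancel₀ _ (by positivity), Nat.floor_natCast] at value_le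

theorem dyadicLimit_lt {x y : ℝ} (hx : 0 ≤ x) (hxy : x < y) (hy : y ≤ 1) :
    dyadicLimit ξ x < dyadicLimit ξ y := by
  obtain ⟨n, k, x_lt, lt_y⟩ := exists_lt_dyadic_succ_lt hx hxy
  have k_lt : k + 1 ≤ 2 ^ n := natCast_div_two_pow_le_one_iff.1 (lt_y.le.trans hy)
  have k_le : k ≤ 2 ^ n := (Nat.le_succ k).trans k_lt
  calc dyadicLimit ξ x
      ≤ dyadicLimit ξ ((k : ℝ) / 2 ^ n) :=
        h.dyadicLimit_le x_lt.le (natCast_div_two_pow_le_one_iff.2 k_le)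
    _ = dyadicValue ξ n k := h.dyadicLimit_natCast_div k_le
    _ < dyadicValue ξ n (k + 1) := h.dyadicValue_lt_succ n k k_lt
    _ = dyadicLimit ξ ((k + 1 : ℕ) / 2 ^ n) := (h.dyadicLimit_natCast_div k_lt).symm
    _ ≤ dyadicLimit ξ y := h.dyadicLimit_le lt_y.le hy

end IsNondegenerate

/-- The sum of the squares of the lengths of the intervals of generation `n`. Its convergence to
zero forces the images of the dyadic points to be dense. -/
noncomputable def gapSum (ξ : ℕ → ℕ → ℝ) (n : ℕ) : ℝ :=
  ∑ k ∈ Finset.range (2 ^ n), (dyadicValue ξ n (k + 1) - dyadicValue ξ n k) ^ 2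

theorem gapSum_nonneg (ξ : ℕ → ℕ → ℝ) (n : ℕ) : 0 ≤ gapSum ξ n :=
  Finset.sum_nonneg fun _ _ => sq_nonneg _

theorem sq_sub_le_gapSum (ξ : ℕ → ℕ → ℝ) {n k : ℕ} (hk : k < 2 ^ n) :
    (dyadicValue ξ n (k + 1) - dyadicValue ξ n k) ^ 2 ≤ gapSum ξ n :=
  Finset.single_le_sum (f := fun k => (dyadicValue ξ n (k + 1) - dyadicValue ξ n k) ^ 2)
    (fun _ _ => sq_nonneg _) (Finset.mem_range.2 hk)

theorem exists_lt_le_and_le_succ {α : Type*} [LinearOrder α] {a : ℕ → α} {N : ℕ} (hN : 0 < N)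
    {y : α} (h0 : a 0 ≤ y) (h1 : y ≤ a N) : ∃ k < N, a k ≤ y ∧ y ≤ a (k + 1) := by
  induction N, hN using Nat.le_induction with
  | base => exact ⟨0, one_pos, h0, h1⟩
  | succ N _ ih =>
    rcases le_total (a N) y with le_y | y_le
    · exact ⟨N, N.lt_succ_self, le_y, h1⟩
    · obtain ⟨k, k_lt, bounds⟩ := ih y_le
      exact ⟨k, k_lt.trans N.lt_succ_self, bounds⟩

theorem exists_abs_dyadicValue_sub_lt (hS : Tendsto (gapSum ξ) atTop (𝓝 0)) (y : I) {ε : ℝ}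
    (hε : 0 < ε) : ∃ n k : ℕ, k ≤ 2 ^ n ∧ |dyadicValue ξ n k - y| < ε := by
  obtain ⟨n, gapSum_lt⟩ := (hS.eventually (gt_mem_nhds (pow_pos hε 2))).exists
  obtain ⟨k, k_lt, value_le, le_succ⟩ :=
    exists_lt_le_and_le_succ (a := dyadicValue ξ n) (Nat.two_pow_pos n)
      ((dyadicValue_zero ξ n).trans_le y.2.1) (y.2.2.trans_eq (dyadicValue_two_pow ξ n).symm)
  have gap_lt : dyadicValue ξ n (k + 1) - dyadicValue ξ n k < ε :=
    lt_of_pow_lt_pow_left₀ 2 hε.le ((sq_sub_le_gapSum ξ k_lt).trans_lt gapSum_lt)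
  refine ⟨n, k, k_lt.le, ?_⟩
  rw [abs_sub_comm, abs_of_nonneg (sub_nonneg.2 value_le)]
  exact (sub_le_sub_right le_succ _).trans_lt gap_lt

theorem IsNondegenerate.exists_extends (h : IsNondegenerate ξ)
    (hS : Tendsto (gapSum ξ) atTop (𝓝 0)) : ∃ φ : I ≃o I, Extends ξ φ := by
  set F : I → I := fun x => ⟨dyadicLimit ξ x, h.dyadicLimit_mem x.2.2⟩
  have strictMono_F : StrictMono F := fun x y hxy => h.dyadicLimit_lt x.2.1 hxy y.2.2
  have denseRange_F : DenseRange F := fun y => by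
    refine Metric.mem_closure_iff.2 fun ε hε => ?_
    obtain ⟨n, k, k_le, near⟩ := exists_abs_dyadicValue_sub_lt hS y hε
    refine ⟨_, mem_range_self
      ⟨(k : ℝ) / 2 ^ n, by positivity, natCast_div_two_pow_le_one_iff.2 k_le⟩, ?_⟩
    rw [dist_comm, Subtype.dist_eq, Real.dist_eq]
    change |dyadicLimit ξ ((k : ℝ) / 2 ^ n) - y| < ε
    rwa [h.dyadicLimit_natCast_div k_le]
  have isClosed_range : IsClosed (range F) :=
    (isCompact_range (strictMono_F.monotone.continuous_of_denseRange denseRange_F)).isClosed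
  have surjective_F : Function.Surjective F :=
    range_eq_univ.1 (isClosed_range.closure_eq.symm.trans denseRange_F.closure_range)
  refine ⟨StrictMono.orderIsoOfSurjective F strictMono_F surjective_F, fun x n k hx => ?_⟩
  change dyadicLimit ξ x = dyadicValue ξ n k
  rw [hx, h.dyadicLimit_natCast_div (natCast_div_two_pow_le_one_iff.1 (hx ▸ x.2.2))]

theorem gapSum_succ (ξ : ℕ → ℕ → ℝ) (n : ℕ) :
    gapSum ξ (n + 1) = ξ 1 1 ^ 2 * gapSum (fun n k => ξ (n + 1) k) n +
      (1 - ξ 1 1) ^ 2 * gapSum (fun n k => ξ (n + 1) (2 ^ n + k)) n := by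
  rw [gapSum, pow_succ, mul_two, Finset.sum_range_add, gapSum, gapSum, Finset.mul_sum,
    Finset.mul_sum]
  congr 1 <;> refine Finset.sum_congr rfl fun k hk => ?_ <;> rw [Finset.mem_range] at hk
  · rw [dyadicValue_left ξ n _ hk, dyadicValue_left ξ n _ hk.le]
    ring
  · rw [add_assoc, dyadicValue_right ξ n _ hk, dyadicValue_right ξ n _ hk.le]
    ring

theorem gapSum_congr {ξ' : ℕ → ℕ → ℝ} (h : ∀ n k, Odd k → k < 2 ^ n → ξ n k = ξ' n k) (n : ℕ) :
    gapSum ξ n = gapSum ξ' n := by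
  refine Finset.sum_congr rfl fun k hk => ?_
  rw [Finset.mem_range] at hk
  rw [dyadicValue_congr h n _ hk, dyadicValue_congr h n _ hk.le]

end Extension

section AlmostSure

/-- The ratios `w` as a function of two indices, extended by zero to the indices that
`dyadicValue` does not use. -/
def nodeFun (w : Node → ℝ) (n k : ℕ) : ℝ :=
  if h : Odd k ∧ k < 2 ^ n then w ⟨(n, k), h⟩ else 0

theorem nodeFun_of_odd (w : Node → ℝ) {n k : ℕ} (h : Odd k) (h' : k < 2 ^ n) :
    nodeFun w n k = w ⟨(n, k), h, h'⟩ := dif_pos ⟨h, h'⟩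

theorem nodeFun_root (w : Node → ℝ) : nodeFun w 1 1 = (split w).1 :=
  nodeFun_of_odd w odd_one (by norm_num)

theorem nodeFun_left (w : Node → ℝ) {n k : ℕ} (h : Odd k) (h' : k < 2 ^ n) :
    nodeFun w (n + 1) k = nodeFun (split w).2.1 n k := by
  rw [nodeFun_of_odd (split w).2.1 h h']
  exact nodeFun_of_odd w (Node.left ⟨(n, k), h, h'⟩).2.1 (Node.left ⟨(n, k), h, h'⟩).2.2

theorem nodeFun_right (w : Node → ℝ) {n k : ℕ} (h : Odd k) (h' : k < 2 ^ n) :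
    nodeFun w (n + 1) (2 ^ n + k) = nodeFun (split w).2.2 n k := by
  rw [nodeFun_of_odd (split w).2.2 h h']
  exact nodeFun_of_odd w (Node.right ⟨(n, k), h, h'⟩).2.1 (Node.right ⟨(n, k), h, h'⟩).2.2

theorem measurable_nodeFun (n k : ℕ) : Measurable fun w => nodeFun w n k := by
  unfold nodeFun
  split_ifs
  · exact measurable_pi_apply _
  · exact measurable_const

theorem measurable_dyadicValue (n k : ℕ) : Measurable fun w => dyadicValue (nodeFun w) n k := by
  induction n generalizing k with
  | zero => exact measurable_const
  | succ n ih =>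
    rcases Nat.even_or_odd' k with ⟨m, rfl | rfl⟩
    · simp_rw [dyadicValue_even]
      exact ih m
    · simp_rw [dyadicValue_odd]
      exact (ih m).add ((measurable_nodeFun _ _).mul ((ih _).sub (ih _)))

theorem measurable_dyadicLimit :
    Measurable fun q : (Node → ℝ) × ℝ => dyadicLimit (nodeFun q.1) q.2 := by
  refine Measurable.iSup fun n => ?_
  have measurable_value :
      Measurable fun q : (Node → ℝ) × ℕ => dyadicValue (nodeFun q.1) n q.2 :=
    measurable_from_prod_countable_left fun k => measurable_dyadicValue n k
  exact measurable_value.comp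
    (measurable_fst.prodMk (Nat.measurable_floor.comp (measurable_snd.mul_const _)))

theorem measurable_gapSum (n : ℕ) : Measurable fun w => gapSum (nodeFun w) n :=
  Finset.measurable_sum _ fun k _ =>
    ((measurable_dyadicValue n (k + 1)).sub (measurable_dyadicValue n k)).pow_const 2

/-- The ratios for which the proof of `IsNondegenerate.exists_extends` constructs a homeomorphism:
they form a measurable set of full measure. -/
def goodRatios : Set (Node → ℝ) :=
  {w | (∀ j, w j ∈ Ioo (0 : ℝ) 1) ∧ Tendsto (gapSum (nodeFun w)) atTop (𝓝 0)}

theorem measurableSet_goodRatios : MeasurableSet goodRatios := by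
  rw [goodRatios, ofPred_and, ofPred_forall]
  exact (MeasurableSet.iInter fun j => measurable_pi_apply j measurableSet_Ioo).inter
    (measurableSet_tendsto _ measurable_gapSum)

theorem gapSum_nodeFun_succ (w : Node → ℝ) (n : ℕ) :
    gapSum (nodeFun w) (n + 1) = (split w).1 ^ 2 * gapSum (nodeFun (split w).2.1) n +
      (1 - (split w).1) ^ 2 * gapSum (nodeFun (split w).2.2) n := by
  rw [gapSum_succ, gapSum_congr fun n k h h' => nodeFun_left w h h',
    gapSum_congr fun n k h h' => nodeFun_right w h h', nodeFun_root]

theorem lintegral_nodeLaw_split {a b : ℝ → ENNReal} {g : (Node → ℝ) → ENNReal}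
    (ha : Measurable a) (hb : Measurable b) (hg : Measurable g) :
    ∫⁻ w, (a (split w).1 * g (split w).2.1 + b (split w).1 * g (split w).2.2) ∂nodeLaw =
      (∫⁻ u, a u ∂unif + ∫⁻ u, b u ∂unif) * ∫⁻ w, g w ∂nodeLaw := by
  have left_measurable : Measurable fun q : (Node → ℝ) × (Node → ℝ) => g q.1 :=
    hg.comp measurable_fst
  have right_measurable : Measurable fun q : (Node → ℝ) × (Node → ℝ) => g q.2 :=
    hg.comp measurable_snd
  rw [measurePreserving_split.lintegral_comp
      (f := fun q => a q.1 * g q.2.1 + b q.1 * g q.2.2) (by fun_prop),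
    lintegral_add_left (by fun_prop),
    lintegral_prod_mul ha.aemeasurable left_measurable.aemeasurable,
    lintegral_prod_mul hb.aemeasurable right_measurable.aemeasurable,
    measurePreserving_fst.lintegral_comp hg, measurePreserving_snd.lintegral_comp hg, add_mul]

theorem lintegral_sq_unif : ∫⁻ u, ENNReal.ofReal (u ^ 2) ∂unif = ENNReal.ofReal (1 / 3) := by
  rw [← ofReal_integral_eq_lintegral_ofReal]
  · rw [unif, integral_Icc_eq_integral_Ioc, ← intervalIntegral.integral_of_le zero_le_one,
      integral_pow]
    norm_num
  · exact (continuous_pow 2).continuousOn.integrableOn_compact isCompact_Icc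
  · exact Eventually.of_forall fun u => sq_nonneg u

theorem lintegral_one_sub_sq_unif :
    ∫⁻ u, ENNReal.ofReal ((1 - u) ^ 2) ∂unif = ENNReal.ofReal (1 / 3) := by
  rw [← ofReal_integral_eq_lintegral_ofReal]
  · rw [unif, integral_Icc_eq_integral_Ioc, ← intervalIntegral.integral_of_le zero_le_one,
      intervalIntegral.integral_comp_sub_left (fun u => u ^ 2), integral_pow]
    norm_num
  · exact ((continuous_const.sub continuous_id).pow 2).continuousOn.integrableOn_compact
      isCompact_Icc
  · exact Eventually.of_forall fun u => sq_nonneg _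

theorem lintegral_gapSum (n : ℕ) :
    ∫⁻ w, ENNReal.ofReal (gapSum (nodeFun w) n) ∂nodeLaw = ENNReal.ofReal (2 / 3) ^ n := by
  induction n with
  | zero => simp [gapSum, dyadicValue]
  | succ n ih =>
    have ofReal_gapSum (w : Node → ℝ) : ENNReal.ofReal (gapSum (nodeFun w) (n + 1)) =
        ENNReal.ofReal ((split w).1 ^ 2) * ENNReal.ofReal (gapSum (nodeFun (split w).2.1) n) +
          ENNReal.ofReal ((1 - (split w).1) ^ 2) *
            ENNReal.ofReal (gapSum (nodeFun (split w).2.2) n) := by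
      rw [gapSum_nodeFun_succ, ENNReal.ofReal_add (mul_nonneg (sq_nonneg _) (gapSum_nonneg _ _))
        (mul_nonneg (sq_nonneg _) (gapSum_nonneg _ _)), ENNReal.ofReal_mul (sq_nonneg _),
        ENNReal.ofReal_mul (sq_nonneg _)]
    simp_rw [ofReal_gapSum]
    rw [lintegral_nodeLaw_split (a := fun u => ENNReal.ofReal (u ^ 2))
        (b := fun u => ENNReal.ofReal ((1 - u) ^ 2))
        (g := fun w => ENNReal.ofReal (gapSum (nodeFun w) n))
        (by fun_prop) (by fun_prop) (measurable_gapSum n).ennreal_ofReal,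
      lintegral_sq_unif, lintegral_one_sub_sq_unif, ih,
      ← ENNReal.ofReal_add (by norm_num) (by norm_num), pow_succ']
    norm_num

theorem ae_unif_mem_Ioo : ∀ᵐ u ∂unif, u ∈ Ioo (0 : ℝ) 1 := by
  rw [unif, ← restrict_Ioo_eq_restrict_Icc]
  exact ae_restrict_mem measurableSet_Ioo

theorem ae_forall_mem_Ioo : ∀ᵐ w ∂nodeLaw, ∀ j, w j ∈ Ioo (0 : ℝ) 1 :=
  ae_all_iff.2 fun j => (measurePreserving_eval_infinitePi
    (fun _ : Node => unif) j).quasiMeasurePreserving.ae ae_unif_mem_Ioo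

theorem lintegral_tsum_gapSum_ne_top :
    ∫⁻ w, ∑' n, ENNReal.ofReal (gapSum (nodeFun w) n) ∂nodeLaw ≠ ⊤ := by
  rw [lintegral_tsum fun n => ((measurable_gapSum n).ennreal_ofReal).aemeasurable]
  simp_rw [lintegral_gapSum]
  rw [ENNReal.tsum_geometric, ENNReal.inv_ne_top, ← ENNReal.ofReal_one]
  exact (tsub_pos_of_lt ((ENNReal.ofReal_lt_ofReal_iff one_pos).2 (by norm_num))).ne'

theorem ae_mem_goodRatios : ∀ᵐ w ∂nodeLaw, w ∈ goodRatios := by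
  filter_upwards [ae_forall_mem_Ioo,
    ae_lt_top (Measurable.tsum fun n => (measurable_gapSum n).ennreal_ofReal)
      lintegral_tsum_gapSum_ne_top] with w hw tsum_lt_top
  refine ⟨hw, ?_⟩
  have tendsto_toReal := (ENNReal.tendsto_toReal ENNReal.zero_ne_top).comp
    (ENNReal.tendsto_atTop_zero_of_tsum_ne_top tsum_lt_top.ne)
  simpa [Function.comp_def, gapSum_nonneg] using tendsto_toReal

theorem exists_extends_of_mem {w : Node → ℝ} (hw : w ∈ goodRatios) :
    ∃ φ : I ≃o I, Extends (nodeFun w) φ := by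
  refine IsNondegenerate.exists_extends (fun n k h h' => ?_) hw.2
  rw [nodeFun_of_odd w h h']
  exact hw.1 _

theorem ae_exists_extends {Ω : Type*} [MeasurableSpace Ω] {P : Measure Ω}
    {X : ℕ → ℕ → Ω → ℝ} (hX : IsUniformFamily P X) :
    ∀ᵐ ω ∂P, ∃ φ : I ≃o I, Extends (fun n k => X n k ω) φ := by
  filter_upwards [hX.measurePreserving_nodeLaw.quasiMeasurePreserving.ae ae_mem_goodRatios]
    with ω hω
  obtain ⟨φ, hφ⟩ := exists_extends_of_mem hω
  exact ⟨φ, hφ.congr fun n k h h' => nodeFun_of_odd _ h h'⟩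

end AlmostSure

section RandomHomeomorphism

open Classical in
/-- The homeomorphism with the division ratios `w`, as a measurable function of `w`; the identity
for the null set of ratios outside `goodRatios`. -/
noncomputable def homeo (w : Node → ℝ) : I ≃o I :=
  if h : w ∈ goodRatios then (exists_extends_of_mem h).choose else OrderIso.refl I

theorem extends_homeo {w : Node → ℝ} (h : w ∈ goodRatios) : Extends (nodeFun w) (homeo w) := by
  rw [homeo, dif_pos h]
  exact (exists_extends_of_mem h).choose_spec

theorem measurable_homeo : Measurable fun q : (Node → ℝ) × I => ((homeo q.1 q.2 : I) : ℝ) := by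
  classical
  have homeo_eq_ite : (fun q : (Node → ℝ) × I => ((homeo q.1 q.2 : I) : ℝ)) = fun q =>
      if q.1 ∈ goodRatios then dyadicLimit (nodeFun q.1) q.2 else (q.2 : ℝ) := by
    funext q
    split_ifs with hq
    · exact (extends_homeo hq).eq_dyadicLimit _
    · rw [homeo, dif_neg hq, OrderIso.refl_apply]
  have measurable_coe : Measurable fun q : (Node → ℝ) × I => (q.2 : ℝ) :=
    measurable_subtype_coe.comp measurable_snd
  rw [homeo_eq_ite]
  exact Measurable.ite (measurable_fst measurableSet_goodRatios)
    (measurable_dyadicLimit.comp (measurable_fst.prodMk measurable_coe)) measurable_coe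

theorem homeo_left {w : Node → ℝ} (hw : w ∈ goodRatios) (hl : (split w).2.1 ∈ goodRatios) {s v : I}
    (hv : (v : ℝ) = s / 2) :
    ((homeo w v : I) : ℝ) = (split w).1 * (homeo (split w).2.1 s : I) := by
  have tendsto_whole := ((extends_homeo hw).tendsto v).comp (tendsto_add_atTop_nat 1)
  have tendsto_half := ((extends_homeo hl).tendsto s).const_mul (split w).1
  refine tendsto_nhds_unique tendsto_whole (tendsto_half.congr fun n => ?_)
  have scale_eq : (v : ℝ) * 2 ^ (n + 1) = s * 2 ^ n := by rw [hv]; ring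
  have floor_le := floor_mul_two_pow_le s.2.2 n
  rw [Function.comp_apply, scale_eq, dyadicValue_left _ n _ floor_le, nodeFun_root,
    dyadicValue_congr (fun n k h h' => nodeFun_left w h h') n _ floor_le]

theorem homeo_right {w : Node → ℝ} (hw : w ∈ goodRatios) (hr : (split w).2.2 ∈ goodRatios) {s v : I}
    (hv : (v : ℝ) = (1 + s) / 2) :
    ((homeo w v : I) : ℝ) =
      (split w).1 + (1 - (split w).1) * (homeo (split w).2.2 s : I) := by
  have tendsto_whole := ((extends_homeo hw).tendsto v).comp (tendsto_add_atTop_nat 1)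
  have tendsto_half :=
    (((extends_homeo hr).tendsto s).const_mul (1 - (split w).1)).const_add (split w).1
  refine tendsto_nhds_unique tendsto_whole (tendsto_half.congr fun n => ?_)
  have scale_eq : (v : ℝ) * 2 ^ (n + 1) = s * 2 ^ n + ((2 ^ n : ℕ) : ℝ) := by
    rw [hv]
    push_cast
    ring
  have floor_le := floor_mul_two_pow_le s.2.2 n
  rw [Function.comp_apply, scale_eq,
    Nat.floor_add_natCast (mul_nonneg s.2.1 (by positivity)), add_comm ⌊(s : ℝ) * 2 ^ n⌋₊,
    dyadicValue_right _ n _ floor_le, nodeFun_root,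
    dyadicValue_congr (fun n k h h' => nodeFun_right w h h') n _ floor_le]

end RandomHomeomorphism

section LocalComposition

/-- The homeomorphism `φ`, transplanted to the interval `[x, y]` and extended by the identity. In
the degenerate cases `y ≤ x` it is still continuous and fixes `0` and `1`. -/
noncomputable def localMap (φ : I ≃o I) (x y : I) (s : ℝ) : ℝ :=
  s + ((y : ℝ) - x) * (((φ (projIcc 0 1 zero_le_one ((s - x) / (y - x))) : I) : ℝ) -
    (projIcc (0 : ℝ) 1 zero_le_one ((s - x) / (y - x)) : I))

theorem continuous_localMap (φ : I ≃o I) (x y : I) : Continuous (localMap φ x y) := by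
  have continuous_ratio : Continuous fun s : ℝ =>
      projIcc (0 : ℝ) 1 zero_le_one ((s - x) / ((y : ℝ) - x)) :=
    continuous_projIcc.comp (by fun_prop)
  exact continuous_id.add (continuous_const.mul
    ((continuous_subtype_val.comp (φ.continuous.comp continuous_ratio)).sub
      (continuous_subtype_val.comp continuous_ratio)))

theorem localMap_of_nonpos (φ : I ≃o I) {x y : I} {s : ℝ} (h : (s - x) / ((y : ℝ) - x) ≤ 0) :
    localMap φ x y s = s := by
  have map_zero : φ 0 = 0 := φ.map_bot
  have proj_eq : projIcc (0 : ℝ) 1 zero_le_one ((s - x) / (y - x)) = 0 :=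
    projIcc_of_le_left zero_le_one h
  rw [localMap, proj_eq, map_zero, sub_self, mul_zero, add_zero]

theorem localMap_of_one_le (φ : I ≃o I) {x y : I} {s : ℝ} (h : 1 ≤ (s - x) / ((y : ℝ) - x)) :
    localMap φ x y s = s := by
  have map_one : φ 1 = 1 := φ.map_top
  have proj_eq : projIcc (0 : ℝ) 1 zero_le_one ((s - x) / (y - x)) = 1 :=
    projIcc_of_right_le zero_le_one h
  rw [localMap, proj_eq, map_one, sub_self, mul_zero, add_zero]

theorem localMap_zero (φ : I ≃o I) (x y : I) : localMap φ x y 0 = 0 := by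
  rcases lt_trichotomy (x : ℝ) y with h | h | h
  · exact localMap_of_nonpos φ
      (div_nonpos_of_nonpos_of_nonneg (by linarith [x.2.1]) (by linarith))
  · simp [localMap, h]
  · refine localMap_of_one_le φ ?_
    rw [le_div_iff_of_neg (by linarith)]
    linarith [y.2.1]

theorem localMap_one (φ : I ≃o I) (x y : I) : localMap φ x y 1 = 1 := by
  rcases lt_trichotomy (x : ℝ) y with h | h | h
  · refine localMap_of_one_le φ ?_
    rw [le_div_iff₀ (by linarith)]
    linarith [y.2.2]
  · simp [localMap, h]
  · exact localMap_of_nonpos φ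
      (div_nonpos_of_nonneg_of_nonpos (by linarith [x.2.2]) (by linarith))

theorem localMap_add_mul (φ : I ≃o I) {x y : I} (hxy : x < y) (v : I) :
    localMap φ x y (x + ((y : ℝ) - x) * v) = x + ((y : ℝ) - x) * (φ v : I) := by
  have length_ne : (y : ℝ) - x ≠ 0 := (sub_pos.2 (Subtype.coe_lt_coe.2 hxy)).ne'
  rw [localMap, add_sub_cancel_left, mul_div_cancel_left₀ _ length_ne, projIcc_val]
  ring

theorem liftIco_coe_of_mem {B : Type*} {h : ℝ → B} (h_eq : h 0 = h 1) {s : ℝ} (hs : s ∈ I) :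
    AddCircle.liftIco 1 0 h (s : UnitAddCircle) = h s := by
  rcases hs.2.lt_or_eq with s_lt | rfl
  · exact AddCircle.liftIco_coe_apply ⟨hs.1, s_lt.trans_eq (zero_add 1).symm⟩
  · rw [AddCircle.coe_period (1 : ℝ), ← QuotientAddGroup.mk_zero,
      AddCircle.liftIco_coe_apply ⟨le_rfl, by norm_num⟩, h_eq]

theorem exists_unitInterval_coe_eq (c : UnitAddCircle) :
    ∃ s : I, ((s : ℝ) : UnitAddCircle) = c := by
  obtain ⟨s, hs, rfl⟩ := (AddCircle.coe_image_Icc_eq (1 : ℝ) 0).symm ▸ mem_univ c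
  exact ⟨⟨s, by rwa [zero_add] at hs⟩, rfl⟩

variable {𝕜 : Type*} [RCLike 𝕜]

theorem apply_localMap_zero_eq (f : C(UnitAddCircle, 𝕜)) (φ : I ≃o I) (x y : I) :
    f (localMap φ x y 0 : UnitAddCircle) = f (localMap φ x y 1 : UnitAddCircle) := by
  rw [localMap_zero, localMap_one, AddCircle.coe_period (1 : ℝ), QuotientAddGroup.mk_zero]

/-- The function `f ∘ localMap φ x y` on the circle. -/
noncomputable def localComp (f : C(UnitAddCircle, 𝕜)) (φ : I ≃o I) (x y : I) :
    C(UnitAddCircle, 𝕜) where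
  toFun := AddCircle.liftIco 1 0 (fun t : ℝ => f (localMap φ x y t : UnitAddCircle))
  continuous_toFun := AddCircle.liftIco_continuous
    (by rw [zero_add, apply_localMap_zero_eq])
    (f.continuous.comp ((AddCircle.continuous_mk' 1).comp
      (continuous_localMap φ x y))).continuousOn

theorem localComp_apply (f : C(UnitAddCircle, 𝕜)) (φ : I ≃o I) (x y : I) {s : ℝ} (hs : s ∈ I) :
    localComp f φ x y (s : UnitAddCircle) = f (localMap φ x y s : UnitAddCircle) :=
  liftIco_coe_of_mem (h := fun t => f (localMap φ x y t)) (apply_localMap_zero_eq f φ x y) hs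

theorem localComp_zero_one (f : C(UnitAddCircle, 𝕜)) (φ : I ≃o I) :
    localComp f φ 0 1 = circleComp f φ := by
  ext c
  obtain ⟨s, rfl⟩ := exists_unitInterval_coe_eq c
  have localMap_eq := localMap_add_mul φ (x := 0) (y := 1) zero_lt_one s
  simp only [Icc.coe_zero, Icc.coe_one, sub_zero, one_mul, zero_add]
    at localMap_eq
  rw [localComp_apply f φ 0 1 s.2, circleComp_apply, localMap_eq]

end LocalComposition

section Measurability

theorem measurable_dist_of_eval {α K E : Type*} [MeasurableSpace α] [TopologicalSpace K]
    [CompactSpace K] [TopologicalSpace.SeparableSpace K] [PseudoMetricSpace E]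
    {g : α → C(K, E)} (f : C(K, E)) (hg : ∀ t, Measurable fun a => dist (g a t) (f t)) :
    Measurable fun a => dist (g a) f := by
  obtain ⟨s, s_countable, s_dense⟩ := TopologicalSpace.exists_countable_dense K
  refine measurable_of_Iic fun r => ?_
  rcases lt_or_ge r 0 with r_neg | r_nonneg
  · have preimage_eq : (fun a => dist (g a) f) ⁻¹' Iic r = ∅ :=
      eq_empty_of_forall_notMem fun a => (r_neg.trans_le dist_nonneg).not_ge
    rw [preimage_eq]
    exact MeasurableSet.empty
  · have preimage_eq : (fun a => dist (g a) f) ⁻¹' Iic r =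
        ⋂ t ∈ s, (fun a => dist (g a t) (f t)) ⁻¹' Iic r := by
      ext a
      simp only [mem_preimage, mem_Iic, mem_iInter, ContinuousMap.dist_le r_nonneg]
      refine ⟨fun h t _ => h t, fun h t => ?_⟩
      exact s_dense.induction (P := fun t => dist (g a t) (f t) ≤ r) h
        (isClosed_le ((g a).continuous.dist f.continuous) continuous_const) t
    rw [preimage_eq]
    exact MeasurableSet.biInter s_countable fun t _ => hg t measurableSet_Iic

theorem measurable_borel_of_dist {α E : Type*} [MeasurableSpace α] [PseudoMetricSpace E]
    [SecondCountableTopology E] {g : α → E} (hg : ∀ c, Measurable fun a => dist (g a) c) :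
    Measurable[_, borel E] g := by
  have isTopologicalBasis_balls : TopologicalSpace.IsTopologicalBasis
      {s : Set E | ∃ c r, s = Metric.ball c r} := by
    refine TopologicalSpace.isTopologicalBasis_of_isOpen_of_nhds ?_ fun c U hc hU => ?_
    · rintro _ ⟨c, r, rfl⟩
      exact Metric.isOpen_ball
    · obtain ⟨r, r_pos, ball_subset⟩ := Metric.isOpen_iff.1 hU c hc
      exact ⟨_, ⟨c, r, rfl⟩, Metric.mem_ball_self r_pos, ball_subset⟩
  rw [borel_eq_generateFrom_of_subbasis isTopologicalBasis_balls.eq_generateFrom]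
  refine measurable_generateFrom ?_
  rintro _ ⟨c, r, rfl⟩
  exact hg c measurableSet_Iio

variable {𝕜 : Type*} [RCLike 𝕜]

theorem measurable_localMap (s : ℝ) :
    Measurable fun q : (Node → ℝ) × I × I => localMap (homeo q.1) q.2.1 q.2.2 s := by
  have measurable_left : Measurable fun q : (Node → ℝ) × I × I => ((q.2.1 : I) : ℝ) :=
    measurable_subtype_coe.comp (measurable_fst.comp measurable_snd)
  have measurable_right : Measurable fun q : (Node → ℝ) × I × I => ((q.2.2 : I) : ℝ) :=
    measurable_subtype_coe.comp (measurable_snd.comp measurable_snd)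
  have measurable_ratio : Measurable fun q : (Node → ℝ) × I × I =>
      projIcc (0 : ℝ) 1 zero_le_one ((s - q.2.1) / ((q.2.2 : ℝ) - q.2.1)) :=
    continuous_projIcc.measurable.comp
      ((measurable_left.const_sub s).div (measurable_right.sub measurable_left))
  exact measurable_const.add ((measurable_right.sub measurable_left).mul
    ((measurable_homeo.comp (measurable_fst.prodMk measurable_ratio)).sub
      (measurable_subtype_coe.comp measurable_ratio)))

theorem measurable_borel_localComp (f : C(UnitAddCircle, 𝕜)) :
    Measurable[_, borel C(UnitAddCircle, 𝕜)]
      fun q : (Node → ℝ) × I × I => localComp f (homeo q.1) q.2.1 q.2.2 := by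
  refine measurable_borel_of_dist fun g => measurable_dist_of_eval g fun t => ?_
  obtain ⟨s, rfl⟩ := exists_unitInterval_coe_eq t
  simp_rw [localComp_apply f _ _ _ s.2]
  have continuous_dist : Continuous fun r : ℝ =>
      dist (f (r : UnitAddCircle)) (g ((s : ℝ) : UnitAddCircle)) :=
    (f.continuous.comp (AddCircle.continuous_mk' 1)).dist continuous_const
  exact continuous_dist.measurable.comp (measurable_localMap s)

/-- The triples `(w, x, y)` with `x ≤ y` for which `T` holds on `[x, y]` for the composition of `f`
with the homeomorphism `homeo w` transplanted to `[x, y]`. -/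
def localEvent (T : C(UnitAddCircle, 𝕜) → I → I → Fin 2) (f : C(UnitAddCircle, 𝕜)) :
    Set ((Node → ℝ) × I × I) :=
  {q | q.2.1 ≤ q.2.2 ∧ T (localComp f (homeo q.1) q.2.1 q.2.2) q.2.1 q.2.2 = 1}

theorem measurableSet_localEvent {T : C(UnitAddCircle, 𝕜) → I → I → Fin 2}
    (hT : IsIntervalProperty T) (f : C(UnitAddCircle, 𝕜)) : MeasurableSet (localEvent T f) := by
  let _ : MeasurableSpace C(UnitAddCircle, 𝕜) := borel _
  have : BorelSpace C(UnitAddCircle, 𝕜) := ⟨rfl⟩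
  have borel_measurable := hT.borel_measurable
  rw [← BorelSpace.measurable_eq (α := C(UnitAddCircle, 𝕜) × I × I)] at borel_measurable
  exact ((measurable_borel_localComp f).prodMk measurable_snd) borel_measurable

end Measurability

section Splitting

/-- The point dividing `[x, y]` in the ratio `u : 1 - u`, for `x ≤ y` and `u ∈ [0,1]`; the
projection onto `[0,1]` only makes it total. -/
noncomputable def divPoint (x y : I) (u : ℝ) : I :=
  projIcc 0 1 zero_le_one ((x : ℝ) + ((y : ℝ) - x) * u)

theorem measurable_divPoint (x y : I) : Measurable (divPoint x y) :=
  continuous_projIcc.measurable.comp (by fun_prop)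

theorem coe_divPoint {x y : I} (hxy : x ≤ y) {u : ℝ} (hu : u ∈ I) :
    (divPoint x y u : ℝ) = x + ((y : ℝ) - x) * u := by
  have length_nonneg : (0 : ℝ) ≤ y - x := sub_nonneg.2 hxy
  rw [divPoint, projIcc_of_mem zero_le_one]
  exact ⟨add_nonneg x.2.1 (mul_nonneg length_nonneg hu.1), by
    linarith [mul_le_of_le_one_right length_nonneg hu.2, y.2.2]⟩

theorem left_lt_divPoint {x y : I} (hxy : x < y) {u : ℝ} (hu : u ∈ Ioo (0 : ℝ) 1) :
    x < divPoint x y u := by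
  have length_pos : (0 : ℝ) < y - x := sub_pos.2 hxy
  rw [← Subtype.coe_lt_coe, coe_divPoint hxy.le (Ioo_subset_Icc_self hu)]
  linarith [mul_pos length_pos hu.1]

theorem divPoint_lt_right {x y : I} (hxy : x < y) {u : ℝ} (hu : u ∈ Ioo (0 : ℝ) 1) :
    divPoint x y u < y := by
  have length_pos : (0 : ℝ) < y - x := sub_pos.2 hxy
  rw [← Subtype.coe_lt_coe, coe_divPoint hxy.le (Ioo_subset_Icc_self hu)]
  linarith [mul_lt_of_lt_one_right length_pos hu.2]

theorem preimage_affine_Icc {a b c d : ℝ} (hcd : c < d) (hab : a < b) :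
    (fun z : ℝ => (b - a) / (d - c) * z + (a - (b - a) / (d - c) * c)) ⁻¹' Icc a b = Icc c d := by
  have source_pos : 0 < d - c := sub_pos.2 hcd
  have target_pos : 0 < b - a := sub_pos.2 hab
  change (fun z => (b - a) / (d - c) * z) ⁻¹'
    ((fun z => z + (a - (b - a) / (d - c) * c)) ⁻¹' Icc a b) = Icc c d
  rw [preimage_add_const_Icc, preimage_const_mul_Icc₀ _ _ (div_pos target_pos source_pos)]
  congr 1
  · field_simp
    ring
  · field_simp
    ring

variable {𝕜 : Type*} [RCLike 𝕜] {T : C(UnitAddCircle, 𝕜) → I → I → Fin 2}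

theorem localComp_add_mul (f : C(UnitAddCircle, 𝕜)) (φ : I ≃o I) {x y : I} (hxy : x < y) (v : I) :
    localComp f φ x y (((x : ℝ) + ((y : ℝ) - x) * v : ℝ) : UnitAddCircle) =
      f (((x : ℝ) + ((y : ℝ) - x) * (φ v : I) : ℝ) : UnitAddCircle) := by
  rw [localComp_apply f φ x y (coe_divPoint hxy.le v.2 ▸ (divPoint x y v).2),
    localMap_add_mul φ hxy v]

namespace IsIntervalProperty

theorem eq_of_affine (hT : IsIntervalProperty T) {f g : C(UnitAddCircle, 𝕜)}
    {a b c d : I} (hab : a < b) (hcd : c < d)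
    (h : ∀ v : I, g (((c : ℝ) + ((d : ℝ) - c) * v : ℝ) : UnitAddCircle) =
      f (((a : ℝ) + ((b : ℝ) - a) * v : ℝ) : UnitAddCircle)) : T g c d = T f a b := by
  have target_pos : (0 : ℝ) < b - a := sub_pos.2 hab
  have source_pos : (0 : ℝ) < d - c := sub_pos.2 hcd
  refine hT.affine f g (((b : ℝ) - a) / (d - c)) (a - ((b : ℝ) - a) / (d - c) * c) a b c d
    (div_pos target_pos source_pos).ne' hab.le hcd.le (preimage_affine_Icc hcd hab)
    fun z hz => ?_
  have ratio_mem : (z - c) / ((d : ℝ) - c) ∈ I :=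
    ⟨div_nonneg (sub_nonneg.2 hz.1) source_pos.le,
      (div_le_one source_pos).2 (sub_le_sub_right hz.2 _)⟩
  have source_eq : (c : ℝ) + ((d : ℝ) - c) * ((z - c) / ((d : ℝ) - c)) = z := by
    rw [mul_div_cancel₀ _ source_pos.ne', add_sub_cancel]
  have target_eq : (a : ℝ) + ((b : ℝ) - a) * ((z - c) / ((d : ℝ) - c)) =
      ((b : ℝ) - a) / (d - c) * z + (a - ((b : ℝ) - a) / (d - c) * c) := by ring
  simpa only [source_eq, target_eq] using h ⟨_, ratio_mem⟩

theorem localComp_left_half (hT : IsIntervalProperty T) (f : C(UnitAddCircle, 𝕜))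
    {w : Node → ℝ} (hw : w ∈ goodRatios) (hl : (split w).2.1 ∈ goodRatios) {x y : I}
    (hxy : x < y) :
    T (localComp f (homeo w) x y) x (divPoint x y (1 / 2)) =
      T (localComp f (homeo (split w).2.1) x (divPoint x y (split w).1)) x
        (divPoint x y (split w).1) := by
  have half_mem : (1 / 2 : ℝ) ∈ Ioo (0 : ℝ) 1 := by norm_num
  have root_mem : (split w).1 ∈ Ioo (0 : ℝ) 1 := hw.1 _
  have lt_divPoint := left_lt_divPoint hxy root_mem
  refine hT.eq_of_affine lt_divPoint (left_lt_divPoint hxy half_mem) fun s => ?_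
  have half_s_mem : (s : ℝ) / 2 ∈ I := ⟨by linarith [s.2.1], by linarith [s.2.2]⟩
  have source_eq : (x : ℝ) + ((divPoint x y (1 / 2) : ℝ) - x) * s =
      x + ((y : ℝ) - x) * (⟨(s : ℝ) / 2, half_s_mem⟩ : I) := by
    rw [coe_divPoint hxy.le (Ioo_subset_Icc_self half_mem)]
    ring
  rw [source_eq, localComp_add_mul f _ hxy, localComp_add_mul f _ lt_divPoint,
    homeo_left hw hl (s := s) rfl, coe_divPoint hxy.le (Ioo_subset_Icc_self root_mem)]
  congr 2
  ring

theorem localComp_right_half (hT : IsIntervalProperty T) (f : C(UnitAddCircle, 𝕜))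
    {w : Node → ℝ} (hw : w ∈ goodRatios) (hr : (split w).2.2 ∈ goodRatios) {x y : I}
    (hxy : x < y) :
    T (localComp f (homeo w) x y) (divPoint x y (1 / 2)) y =
      T (localComp f (homeo (split w).2.2) (divPoint x y (split w).1) y)
        (divPoint x y (split w).1) y := by
  have half_mem : (1 / 2 : ℝ) ∈ Ioo (0 : ℝ) 1 := by norm_num
  have root_mem : (split w).1 ∈ Ioo (0 : ℝ) 1 := hw.1 _
  have divPoint_lt := divPoint_lt_right hxy root_mem
  refine hT.eq_of_affine divPoint_lt (divPoint_lt_right hxy half_mem) fun s => ?_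
  have half_s_mem : (1 + (s : ℝ)) / 2 ∈ I := ⟨by linarith [s.2.1], by linarith [s.2.2]⟩
  have source_eq : (divPoint x y (1 / 2) : ℝ) + ((y : ℝ) - divPoint x y (1 / 2)) * s =
      x + ((y : ℝ) - x) * (⟨(1 + (s : ℝ)) / 2, half_s_mem⟩ : I) := by
    rw [coe_divPoint hxy.le (Ioo_subset_Icc_self half_mem)]
    ring
  rw [source_eq, localComp_add_mul f _ hxy, localComp_add_mul f _ divPoint_lt,
    homeo_right hw hr (s := s) rfl, coe_divPoint hxy.le (Ioo_subset_Icc_self root_mem)]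
  congr 2
  ring

theorem localComp_eq_mul (hT : IsIntervalProperty T) (f : C(UnitAddCircle, 𝕜))
    {w : Node → ℝ} (hw : w ∈ goodRatios) (hl : (split w).2.1 ∈ goodRatios)
    (hr : (split w).2.2 ∈ goodRatios) {x y : I} (hxy : x < y) :
    T (localComp f (homeo w) x y) x y =
      T (localComp f (homeo (split w).2.1) x (divPoint x y (split w).1)) x
          (divPoint x y (split w).1) *
        T (localComp f (homeo (split w).2.2) (divPoint x y (split w).1) y)
          (divPoint x y (split w).1) y := by
  have half_mem : (1 / 2 : ℝ) ∈ Ioo (0 : ℝ) 1 := by norm_num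
  rw [hT.mul _ x (divPoint x y (1 / 2)) y (left_lt_divPoint hxy half_mem).le
      (divPoint_lt_right hxy half_mem).le,
    hT.localComp_left_half f hw hl hxy, hT.localComp_right_half f hw hr hxy]

end IsIntervalProperty

end Splitting

section SelfSimilarity

theorem nodeLaw_split_preimage {B₀ : Set ℝ} {B₁ B₂ : Set (Node → ℝ)} (h₀ : MeasurableSet B₀)
    (h₁ : MeasurableSet B₁) (h₂ : MeasurableSet B₂) :
    nodeLaw (split ⁻¹' (B₀ ×ˢ (B₁ ×ˢ B₂))) = unif B₀ * (nodeLaw B₁ * nodeLaw B₂) := by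
  rw [measurePreserving_split.measure_preimage (h₀.prod (h₁.prod h₂)).nullMeasurableSet,
    Measure.prod_prod, Measure.prod_prod]

theorem nodeLaw_split_preimage_eq_lintegral {B : Set ℝ} {A₁ A₂ : ℝ → Set (Node → ℝ)}
    (hB : MeasurableSet B)
    (hA : MeasurableSet {q : ℝ × (Node → ℝ) × (Node → ℝ) | q.2.1 ∈ A₁ q.1 ∧ q.2.2 ∈ A₂ q.1}) :
    nodeLaw (split ⁻¹' ({q | q.2.1 ∈ A₁ q.1 ∧ q.2.2 ∈ A₂ q.1} ∩ B ×ˢ univ)) =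
      ∫⁻ u in B, nodeLaw (A₁ u) * nodeLaw (A₂ u) ∂unif := by
  rw [measurePreserving_split.measure_preimage
      (hA.inter (hB.prod MeasurableSet.univ)).nullMeasurableSet,
    ← Measure.restrict_apply hA, ← Measure.prod_restrict, Measure.restrict_univ,
    Measure.prod_apply hA]
  exact lintegral_congr fun u => Measure.prod_prod (A₁ u) (A₂ u)

theorem univ_pi_eq_split_preimage (t : Node → Set ℝ) :
    univ.pi t = split ⁻¹' (t Node.root ×ˢ
      (univ.pi (fun j => t j.left) ×ˢ univ.pi fun j => t j.right)) := by
  ext w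
  simp only [mem_univ_pi, mem_preimage, mem_prod, split]
  refine ⟨fun h => ⟨h _, fun j => h _, fun j => h _⟩, fun ⟨h_root, h_left, h_right⟩ j => ?_⟩
  rcases Node.eq_root_or_eq_left_or_eq_right j with rfl | ⟨i, rfl⟩ | ⟨i, rfl⟩
  · exact h_root
  · exact h_left i
  · exact h_right i

theorem fin_two_mul_eq_one (a b : Fin 2) : a * b = 1 ↔ a = 1 ∧ b = 1 := by
  revert a b
  decide

variable {𝕜 : Type*} [RCLike 𝕜] {T : C(UnitAddCircle, 𝕜) → I → I → Fin 2}

/-- The ratios for which `T` holds on `[x, y]` for the transplanted homeomorphism: the section of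
`localEvent` over `(x, y)`. -/
def eventOn (T : C(UnitAddCircle, 𝕜) → I → I → Fin 2) (f : C(UnitAddCircle, 𝕜)) (x y : I) :
    Set (Node → ℝ) :=
  (fun w => (w, x, y)) ⁻¹' localEvent T f

theorem measurableSet_eventOn (hT : IsIntervalProperty T) (f : C(UnitAddCircle, 𝕜)) (x y : I) :
    MeasurableSet (eventOn T f x y) :=
  measurable_prodMk_right (measurableSet_localEvent hT f)

theorem measurable_measure_eventOn (hT : IsIntervalProperty T) (f : C(UnitAddCircle, 𝕜)) :
    Measurable fun r : I × I => nodeLaw (eventOn T f r.1 r.2) :=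
  measurable_measure_prodMk_right (measurableSet_localEvent hT f)

theorem ae_mem_eventOn_iff (hT : IsIntervalProperty T) (f : C(UnitAddCircle, 𝕜)) {x y : I}
    (hxy : x < y) : ∀ᵐ w ∂nodeLaw, (w ∈ eventOn T f x y ↔
      (split w).2.1 ∈ eventOn T f x (divPoint x y (split w).1) ∧
        (split w).2.2 ∈ eventOn T f (divPoint x y (split w).1) y) := by
  have halves := measurePreserving_snd.comp measurePreserving_split
  have ae_left_mem := (measurePreserving_fst.comp halves).quasiMeasurePreserving.ae
    ae_mem_goodRatios
  have ae_right_mem := (measurePreserving_snd.comp halves).quasiMeasurePreserving.ae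
    ae_mem_goodRatios
  filter_upwards [ae_mem_goodRatios, ae_left_mem, ae_right_mem] with w hw hl hr
  have root_mem : (split w).1 ∈ Ioo (0 : ℝ) 1 := hw.1 _
  simp only [eventOn, localEvent, mem_preimage, mem_ofPred_eq, hxy.le,
    (left_lt_divPoint hxy root_mem).le, (divPoint_lt_right hxy root_mem).le, true_and,
    hT.localComp_eq_mul f hw hl hr hxy, fin_two_mul_eq_one]

theorem measurableSet_eventOn_halves (hT : IsIntervalProperty T) (f : C(UnitAddCircle, 𝕜))
    (x y : I) {B₁ B₂ : Set (Node → ℝ)} (h₁ : MeasurableSet B₁) (h₂ : MeasurableSet B₂) :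
    MeasurableSet {q : ℝ × (Node → ℝ) × (Node → ℝ) |
      q.2.1 ∈ eventOn T f x (divPoint x y q.1) ∩ B₁ ∧
        q.2.2 ∈ eventOn T f (divPoint x y q.1) y ∩ B₂} := by
  have measurable_point : Measurable fun q : ℝ × (Node → ℝ) × (Node → ℝ) => divPoint x y q.1 :=
    (measurable_divPoint x y).comp measurable_fst
  have measurable_left : Measurable fun q : ℝ × (Node → ℝ) × (Node → ℝ) => q.2.1 :=
    measurable_fst.comp measurable_snd
  have measurable_right : Measurable fun q : ℝ × (Node → ℝ) × (Node → ℝ) => q.2.2 :=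
    measurable_snd.comp measurable_snd
  have measurable_event := measurableSet_localEvent hT f
  exact (((measurable_left.prodMk (measurable_const.prodMk measurable_point))
      measurable_event).inter (measurable_left h₁)).inter
    (((measurable_right.prodMk (measurable_point.prodMk measurable_const))
      measurable_event).inter (measurable_right h₂))

theorem measure_eventOn_inter (hT : IsIntervalProperty T) (f : C(UnitAddCircle, 𝕜)) {x y : I}
    (hxy : x < y) {B₀ : Set ℝ} {B₁ B₂ : Set (Node → ℝ)} (h₀ : MeasurableSet B₀)
    (h₁ : MeasurableSet B₁) (h₂ : MeasurableSet B₂) :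
    nodeLaw (eventOn T f x y ∩ split ⁻¹' (B₀ ×ˢ (B₁ ×ˢ B₂))) =
      ∫⁻ u in B₀, nodeLaw (eventOn T f x (divPoint x y u) ∩ B₁) *
        nodeLaw (eventOn T f (divPoint x y u) y ∩ B₂) ∂unif := by
  rw [← nodeLaw_split_preimage_eq_lintegral h₀ (measurableSet_eventOn_halves hT f x y h₁ h₂)]
  refine measure_congr ?_
  filter_upwards [ae_mem_eventOn_iff hT f hxy] with w hw
  refine propext ⟨fun ⟨hx, h_root, h_left, h_right⟩ => ?_, fun ⟨⟨h_left, h_right⟩, h_root, _⟩ => ?_⟩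
  · exact ⟨⟨⟨(hw.1 hx).1, h_left⟩, (hw.1 hx).2, h_right⟩, h_root, mem_univ _⟩
  · exact ⟨hw.2 ⟨h_left.1, h_right.1⟩, h_root, h_left.2, h_right.2⟩

theorem measure_eventOn (hT : IsIntervalProperty T) (f : C(UnitAddCircle, 𝕜)) {x y : I}
    (hxy : x < y) : nodeLaw (eventOn T f x y) =
      ∫⁻ u, nodeLaw (eventOn T f x (divPoint x y u)) *
        nodeLaw (eventOn T f (divPoint x y u) y) ∂unif := by
  simpa only [univ_prod_univ, preimage_univ, inter_univ, Measure.restrict_univ] using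
    measure_eventOn_inter hT f hxy MeasurableSet.univ MeasurableSet.univ MeasurableSet.univ

theorem measureReal_eventOn (hT : IsIntervalProperty T) (f : C(UnitAddCircle, 𝕜)) {x y : I}
    (hxy : x < y) : nodeLaw.real (eventOn T f x y) =
      ∫ u, nodeLaw.real (eventOn T f x (divPoint x y u)) *
        nodeLaw.real (eventOn T f (divPoint x y u) y) ∂unif := by
  have measurable_left : Measurable fun u => nodeLaw (eventOn T f x (divPoint x y u)) :=
    (measurable_measure_eventOn hT f).comp (measurable_const.prodMk (measurable_divPoint x y))
  have measurable_right : Measurable fun u => nodeLaw (eventOn T f (divPoint x y u) y) :=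
    (measurable_measure_eventOn hT f).comp ((measurable_divPoint x y).prodMk measurable_const)
  have measurable_mul : Measurable fun u => nodeLaw (eventOn T f x (divPoint x y u)) *
      nodeLaw (eventOn T f (divPoint x y u) y) := measurable_left.mul measurable_right
  rw [measureReal_def, measure_eventOn hT f hxy, ← integral_toReal measurable_mul.aemeasurable
      (Eventually.of_forall fun u => ENNReal.mul_lt_top (measure_lt_top _ _) (measure_lt_top _ _))]
  simp only [ENNReal.toReal_mul, measureReal_def]

/-- The probability, as a function of `0 ≤ x < y ≤ 1`, that `T` holds on `[x, y]` for the
transplanted homeomorphism. It is extended by zero to the other real `x`, `y`, which preserves its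
self-averaging. -/
noncomputable def prob (T : C(UnitAddCircle, 𝕜) → I → I → Fin 2) (f : C(UnitAddCircle, 𝕜))
    (x y : ℝ) : ℝ :=
  {q : ℝ × ℝ | 0 ≤ q.1 ∧ q.1 < q.2 ∧ q.2 ≤ 1}.indicator
    (fun q => nodeLaw.real (eventOn T f (projIcc 0 1 zero_le_one q.1)
      (projIcc 0 1 zero_le_one q.2))) (x, y)

theorem prob_of_lt (f : C(UnitAddCircle, 𝕜)) {x y : I} (hxy : x < y) :
    prob T f x y = nodeLaw.real (eventOn T f x y) := by
  have mem : ((x : ℝ), (y : ℝ)) ∈ {q : ℝ × ℝ | 0 ≤ q.1 ∧ q.1 < q.2 ∧ q.2 ≤ 1} :=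
    ⟨x.2.1, hxy, y.2.2⟩
  simp only [prob, indicator_of_mem mem, projIcc_val]

theorem prob_of_neg (f : C(UnitAddCircle, 𝕜)) {x : ℝ} (hx : x < 0) (y : ℝ) : prob T f x y = 0 :=
  indicator_of_notMem (fun h => hx.not_ge h.1) _

theorem prob_of_one_lt (f : C(UnitAddCircle, 𝕜)) (x : ℝ) {y : ℝ} (hy : 1 < y) :
    prob T f x y = 0 :=
  indicator_of_notMem (fun h => hy.not_ge h.2.2) _

theorem measurable_prob (hT : IsIntervalProperty T) (f : C(UnitAddCircle, 𝕜)) :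
    Measurable (Function.uncurry (prob T f)) := by
  have measurable_proj : Measurable (projIcc (0 : ℝ) 1 zero_le_one) :=
    continuous_projIcc.measurable
  refine Measurable.indicator ?_ ((measurableSet_le measurable_const measurable_fst).inter
    ((measurableSet_lt measurable_fst measurable_snd).inter
      (measurableSet_le measurable_snd measurable_const)))
  exact (measurable_measure_eventOn hT f).ennreal_toReal.comp
    ((measurable_proj.comp measurable_fst).prodMk (measurable_proj.comp measurable_snd))

theorem integral_unif_comp_add_mul (g : ℝ → ℝ) {x y : ℝ} (hxy : x ≠ y) :
    (y - x) * ∫ u, g (x + (y - x) * u) ∂unif = ∫ t in x..y, g t := by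
  rw [unif, integral_Icc_eq_integral_Ioc, ← intervalIntegral.integral_of_le zero_le_one,
    intervalIntegral.integral_comp_add_mul g (sub_ne_zero.2 hxy.symm), mul_zero, add_zero, mul_one,
    add_sub_cancel, smul_eq_mul, mul_inv_cancel_left₀ (sub_ne_zero.2 hxy.symm)]

theorem prob_eq_integral (hT : IsIntervalProperty T) (f : C(UnitAddCircle, 𝕜)) {x y : I}
    (hxy : x < y) : ((y : ℝ) - x) * prob T f x y = ∫ t in x..y, prob T f x t * prob T f t y := by
  rw [← integral_unif_comp_add_mul _ (Subtype.coe_lt_coe.2 hxy).ne, prob_of_lt f hxy,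
    measureReal_eventOn hT f hxy]
  congr 1
  refine integral_congr_ae ?_
  filter_upwards [ae_unif_mem_Ioo] with u hu
  rw [← coe_divPoint hxy.le (Ioo_subset_Icc_self hu), prob_of_lt f (left_lt_divPoint hxy hu),
    prob_of_lt f (divPoint_lt_right hxy hu)]

theorem isSelfAveraging_prob (hT : IsIntervalProperty T) (f : C(UnitAddCircle, 𝕜)) :
    IsSelfAveraging (prob T f) where
  measurable := measurable_prob hT f
  nonneg x y := indicator_nonneg (fun _ _ => measureReal_nonneg) _
  le_one x y := indicator_apply_le' (fun _ => measureReal_le_one) fun _ => zero_le_one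
  eq_integral x y hxy := by
    rcases lt_or_ge x 0 with hx | hx
    · simp [prob_of_neg f hx]
    rcases lt_or_ge 1 y with hy | hy
    · simp [prob_of_one_lt f _ hy]
    · exact prob_eq_integral hT f (x := ⟨x, hx, hxy.le.trans hy⟩)
        (y := ⟨y, hx.trans hxy.le, hy⟩) hxy

theorem quasiMeasurePreserving_unif_add_mul (a : ℝ) {b : ℝ} (hb : b ≠ 0) :
    Measure.QuasiMeasurePreserving (fun u => a + b * u) unif volume := by
  have mul_left : Measure.QuasiMeasurePreserving (fun u : ℝ => b * u) := by
    refine ⟨measurable_const_mul b, ?_⟩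
    rw [Real.map_volume_mul_left hb]
    exact Measure.smul_absolutelyContinuous
  exact ((measurePreserving_add_left volume a).quasiMeasurePreserving.comp mul_left).mono_left
    (Measure.absolutelyContinuous_of_le Measure.restrict_le_self)

theorem ae_measure_eventOn_mul (hT : IsIntervalProperty T) (f : C(UnitAddCircle, 𝕜)) {x y : I}
    (hxy : x < y) : ∀ᵐ u ∂unif, nodeLaw (eventOn T f x (divPoint x y u)) *
      nodeLaw (eventOn T f (divPoint x y u) y) = nodeLaw (eventOn T f x y) := by
  have length_ne : (y : ℝ) - x ≠ 0 := (sub_pos.2 (Subtype.coe_lt_coe.2 hxy)).ne'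
  filter_upwards [(quasiMeasurePreserving_unif_add_mul x length_ne).ae
    (isSelfAveraging_prob hT f).ae_eq_mul, ae_unif_mem_Ioo] with u prob_eq_mul hu
  have lt_point := left_lt_divPoint hxy hu
  have point_lt := divPoint_lt_right hxy hu
  rw [← coe_divPoint hxy.le (Ioo_subset_Icc_self hu)] at prob_eq_mul
  have real_eq_mul := prob_eq_mul x y lt_point point_lt
  rw [prob_of_lt f lt_point, prob_of_lt f point_lt, prob_of_lt f hxy] at real_eq_mul
  refine (ENNReal.toReal_eq_toReal_iff' (ENNReal.mul_ne_top (measure_ne_top _ _)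
    (measure_ne_top _ _)) (measure_ne_top _ _)).1 ?_
  rw [ENNReal.toReal_mul]
  exact real_eq_mul.symm

/-- The induction step conditions on the image of the midpoint, which does not change the
probability by `ae_measure_eventOn_mul`; the two halves are then independent. -/
theorem measure_eventOn_inter_pi (hT : IsIntervalProperty T) (f : C(UnitAddCircle, 𝕜)) (n : ℕ)
    (t : Node → Set ℝ) (ht : ∀ j, MeasurableSet (t j)) (t_eq_univ : ∀ j, n < j.1.1 → t j = univ)
    {x y : I} (hxy : x < y) :
    nodeLaw (eventOn T f x y ∩ univ.pi t) = nodeLaw (eventOn T f x y) * nodeLaw (univ.pi t) := by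
  induction n generalizing t x y with
  | zero =>
    have pi_eq_univ : univ.pi t = univ :=
      (pi_congr rfl fun j _ => t_eq_univ j j.level_pos).trans (pi_univ _)
    rw [pi_eq_univ, inter_univ, measure_univ, mul_one]
  | succ n ih =>
    set L : Set (Node → ℝ) := univ.pi fun j => t j.left
    set R : Set (Node → ℝ) := univ.pi fun j => t j.right
    have measurableSet_L : MeasurableSet L := MeasurableSet.univ_pi fun j => ht _
    have measurableSet_R : MeasurableSet R := MeasurableSet.univ_pi fun j => ht _
    have halves_independent : ∀ᵐ u ∂(unif.restrict (t Node.root)),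
        nodeLaw (eventOn T f x (divPoint x y u) ∩ L) *
          nodeLaw (eventOn T f (divPoint x y u) y ∩ R) =
        nodeLaw (eventOn T f x y) * (nodeLaw L * nodeLaw R) := by
      refine ae_restrict_of_ae ?_
      filter_upwards [ae_measure_eventOn_mul hT f hxy, ae_unif_mem_Ioo] with u hu u_mem
      rw [ih _ (fun j => ht _) (fun j hj => t_eq_univ _ (Nat.succ_lt_succ hj))
          (left_lt_divPoint hxy u_mem),
        ih _ (fun j => ht _) (fun j hj => t_eq_univ _ (Nat.succ_lt_succ hj))
          (divPoint_lt_right hxy u_mem), ← hu]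
      ring
    rw [univ_pi_eq_split_preimage t,
      measure_eventOn_inter hT f hxy (ht _) measurableSet_L measurableSet_R,
      nodeLaw_split_preimage (ht _) measurableSet_L measurableSet_R,
      lintegral_congr_ae halves_independent, lintegral_const, Measure.restrict_apply_univ]
    ring

theorem measure_eventOn_eq_zero_or_one (hT : IsIntervalProperty T) (f : C(UnitAddCircle, 𝕜))
    {x y : I} (hxy : x < y) :
    nodeLaw (eventOn T f x y) = 0 ∨ nodeLaw (eventOn T f x y) = 1 := by
  classical
  refine infinitePi_eq_zero_or_one_of_inter_pi fun s t ht => ?_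
  rw [← univ_pi_ite (s := (s : Set Node))]
  refine measure_eventOn_inter_pi hT f (s.sup fun j => j.1.1) _ (fun j => ?_) (fun j hj => ?_) hxy
  · split_ifs
    exacts [ht j, MeasurableSet.univ]
  · exact if_neg fun j_mem =>
      hj.not_ge (Finset.le_sup (f := fun j : Node => j.1.1) (Finset.mem_coe.1 j_mem))

end SelfSimilarity

section ZeroOneLaw

variable {𝕜 : Type*} [RCLike 𝕜] {Ω : Type*} [MeasurableSpace Ω] {P : Measure Ω}
  {X : ℕ → ℕ → Ω → ℝ} {T : C(UnitAddCircle, 𝕜) → I → I → Fin 2}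

theorem propertyEvent_ae_eq (hX : IsUniformFamily P X) (f : C(UnitAddCircle, 𝕜)) :
    (propertyEvent X T f : Set Ω) =ᵐ[P]
      (fun ω (j : Node) => X j.1.1 j.1.2 ω) ⁻¹' eventOn T f 0 1 := by
  filter_upwards [hX.measurePreserving_nodeLaw.quasiMeasurePreserving.ae ae_mem_goodRatios]
    with ω hω
  set w : Node → ℝ := fun j => X j.1.1 j.1.2 ω
  have extends_w : Extends (fun n k => X n k ω) (homeo w) :=
    (extends_homeo hω).congr fun n k h h' => nodeFun_of_odd _ h h'
  refine propext ⟨?_, fun h => ⟨homeo w, extends_w, ?_⟩⟩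
  · rintro ⟨φ, hφ, h⟩
    refine ⟨zero_le_one, ?_⟩
    change T (localComp f (homeo w) 0 1) 0 1 = 1
    rwa [localComp_zero_one, extends_w.unique hφ]
  · rw [← localComp_zero_one]
    exact h.2

theorem zero_one_law (hX : IsUniformFamily P X) (hT : IsIntervalProperty T)
    (f : C(UnitAddCircle, 𝕜)) :
    NullMeasurableSet (propertyEvent X T f) P ∧
      (P (propertyEvent X T f) = 0 ∨ P (propertyEvent X T f) = 1) := by
  have measurableSet_event := measurableSet_eventOn hT f 0 1
  have ae_eq := propertyEvent_ae_eq (T := T) hX f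
  refine ⟨(hX.measurePreserving_nodeLaw.measurable
    measurableSet_event).nullMeasurableSet.congr ae_eq.symm, ?_⟩
  rw [measure_congr ae_eq,
    hX.measurePreserving_nodeLaw.measure_preimage measurableSet_event.nullMeasurableSet]
  exact measure_eventOn_eq_zero_or_one hT f zero_lt_one

end ZeroOneLaw

end RandomHomeo

theorem mainTheorem3 {𝕜 : Type*} [RCLike 𝕜] {Ω : Type*} [MeasurableSpace Ω]
    (P : Measure Ω) [IsProbabilityMeasure P] (X : ℕ → ℕ → Ω → ℝ)
    (hX : RandomHomeo.IsUniformFamily P X) :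
    (∀ᵐ ω ∂P, ∃ φ : I ≃o I, RandomHomeo.Extends (fun n k => X n k ω) φ) ∧
    (∀ T : C(UnitAddCircle, 𝕜) → I → I → Fin 2, RandomHomeo.IsIntervalProperty T →
      ∀ f : C(UnitAddCircle, 𝕜),
        NullMeasurableSet (RandomHomeo.propertyEvent X T f) P ∧
        (P (RandomHomeo.propertyEvent X T f) = 0 ∨ P (RandomHomeo.propertyEvent X T f) = 1)) ∧
    (∀ p : ℝ → ℝ → ℝ,
      AEMeasurable (fun q : ℝ × ℝ => p q.1 q.2) (volume.restrict RandomHomeo.triangle) →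
      (∀ x y : ℝ, 0 ≤ x → x ≤ y → y ≤ 1 → 0 ≤ p x y ∧ p x y ≤ 1) →
      (∀ x y : ℝ, 0 ≤ x → x < y → y ≤ 1 →
        p x y = 1 / (y - x) * ∫ t in x..y, p x t * p t y) →
      ∀ᵐ q : ℝ × ℝ × ℝ, 0 ≤ q.1 → q.1 < q.2.1 → q.2.1 < q.2.2 → q.2.2 ≤ 1 →
        p q.1 q.2.2 ≤ p q.1 q.2.1 ∧ p q.1 q.2.2 ≤ p q.2.1 q.2.2 ∧
        p q.1 q.2.2 = p q.1 q.2.1 * p q.2.1 q.2.2) :=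
  ⟨RandomHomeo.ae_exists_extends hX, fun _ hT f => RandomHomeo.zero_one_law hX hT f,
    fun _ hm hp heq => RandomHomeo.ae_eq_mul_of_eq_integral hm hp heq⟩
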